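/- **Theorem (convergence of the manifold inexact augmented Lagrangian method for adaptive sparse CCA).** Let $X\in\mathbb R^{n\times p}$, $Y\in\mathbb R^{n\times q}$ with $X^TX$ and $Y^TY$ positive definite, let $\lambda_u,\lambda_v\ge 0$, and put $\mathcal M_1=\{U\in\mathbb R^{p\times r}: U^TX^TXU=I_r\}$, $\mathcal M_2=\{V\in\mathbb R^{q\times r}: V^TY^TYV=I_r\}$ and $\mathcal N=\mathcal M_1\times\mathcal M_2\times\mathbb R^{n\times pr}\times\mathbb R^{n\times qr}$, a Riemannian submanifold of Euclidean space with the Frobenius inner product. For $W\in\mathbb R^{p\times r}$ with columns $W_{\cdot 1},\dots,W_{\cdot r}$ let $\mathcal A_X(W)=(X\,\mathrm{Diag}(W_{\cdot 1}),\dots,X\,\mathrm{Diag}(W_{\cdot r}))$, and define $\mathcal A_Y$ likewise. For $W=(U,V,P,Q)$ let $$F(W)=\tfrac12\|XU-YV\|_F^2+\lambda_u\|P\|_*+\lambda_v\|Q\|_*,\qquad h_1(W)=\mathcal A_X(U)-P,\quad h_2(W)=\mathcal A_Y(V)-Q,\quad h=(h_1,h_2),$$ where $\|\cdot\|_*$ is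 the nuclear norm, and consider the problem $$\min_W F(W)\quad\text{s.t. } h(W)=0,\ W\in\mathcal N. \tag{1}$$ Let $\mathcal L_\rho(W;\Lambda_1,\Lambda_2)=F(W)-\langle\Lambda_1,h_1(W)\rangle-\langle\Lambda_2,h_2(W)\rangle+\frac\rho2\|h_1(W)\|_F^2+\frac\rho2\|h_2(W)\|_F^2$. For a locally Lipschitz function $f$ let $\partial f(W)\subset T_W\mathcal N$ be the Riemannian (Clarke) subdifferential of $f|_{\mathcal N}$ at $W$: the set of all $\xi\in T_W\mathcal N$ with $\langle\xi,v\rangle\le f^\circ(W;v)$ for all $v\in T_W\mathcal N$, where, for a smooth chart $\varphi$ of $\mathcal N$ around $W$, $$f^\circ(W;v)=\limsup_{y\to W,\ t\downarrow 0}\frac{f(\varphi^{-1}(\varphi(y)+t\,D\varphi(W)v))-f(y)}{t}.$$ Let $0<\tau<1$, $\gamma>1$, $\rho_0>1$, let $\varepsilon_k\to0$, and let $W^k\in\mathcal N$, $\Lambda_1^k,\Lambda_2^k,\rho_k$ ($k=0,1,2,\dots$) be generated by the manifold inexact augmented Lagrangian method (with arbitrary $W^0\in\mathcal N$, $\Lambda_1^0$,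 $\Lambda_2^0$), that is, for every $k\ge 0$: * there is $\delta^k\in\partial\Psi_k(W^{k+1})$ with $\|\delta^k\|\le\varepsilon_k$, where $\Psi_k=\mathcal L_{\rho_k}(\cdot\,;\Lambda_1^k,\Lambda_2^k)$; * $\Lambda_i^{k+1}=\Lambda_i^k-\rho_k h_i(W^{k+1})$ for $i=1,2$; * $\rho_{k+1}=\rho_k$ if $\|h_i(W^{k+1})\|_\infty\le\tau\|h_i(W^k)\|_\infty$ for both $i=1,2$, and $\rho_{k+1}=\gamma\rho_k$ otherwise, where $\|\cdot\|_\infty$ is the largest absolute value of an entry. Then the sequence $\{W^k\}$ has at least one limit point. Moreover, let $W^*$ be any limit point of $\{W^k\}$ at which LICQ holds, i.e. the Riemannian gradients on $\mathcal N$ of all the entries of $h_1$ and $h_2$ at $W^*$ are linearly independent in $T_{W^*}\mathcal N$. Then $W^*$ is a KKT point of (1): $W^*\in\mathcal N$, $h(W^*)=0$, and there are multiplier matrices $Z^1,Z^2$ with $$0\in\partial F(W^*)+\sum_{i,j}Z^1_{ij}\,\mathrm{grad}[h_1(W^*)]_{ij}+\sum_{i,j}Z^2_{ij}\,\mathrm{grad}[h_2(W^*)]_{ij}.$$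 -/

import Mathlib

open Filter Topology
open scoped ContDiff RealInnerProductSpace

noncomputable section

/-! Riemannian notions on an embedded submanifold `S` of a Euclidean space `E`,
with the metric inherited from `E`. -/

section Riemannian

variable {E : Type*} [NormedAddCommGroup E] [InnerProductSpace ℝ E] [FiniteDimensional ℝ E]

/-- The tangent space at `x`: velocities at time `0` of smooth curves in `S` through `x`.
(For a submanifold the set of velocities is already a linear space; the span only serves to
make it a `Submodule` for every set `S`.) -/
def tangentSpaceAt (S : Set E) (x : E) : Submodule ℝ E :=
  Submodule.span ℝ {v | ∃ γ : ℝ → E, ContDiffAt ℝ ∞ γ 0 ∧ γ 0 = x ∧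
    (∀ᶠ t in 𝓝 (0 : ℝ), γ t ∈ S) ∧ HasDerivAt γ v 0}

/-- The Riemannian gradient at `x` of the restriction to `S` of a function `f` that is
differentiable on `E`: the orthogonal projection of the Euclidean gradient to `T_x S`. -/
def riemGrad (S : Set E) (f : E → ℝ) (x : E) : E :=
  haveI : CompleteSpace E := FiniteDimensional.complete ℝ E
  (tangentSpaceAt S x).starProjection (gradient f x)

/-- `ψ`, on the open set `V`, is the inverse `φ⁻¹` of a smooth chart `φ` of `S`: it is a smooth
injective immersion of `V`, and a homeomorphism onto a relatively open part of `S`. -/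
structure IsInverseChart (S : Set E) {d : ℕ} (V : Set (EuclideanSpace ℝ (Fin d)))
    (ψ : EuclideanSpace ℝ (Fin d) → E) : Prop where
  isOpen : IsOpen V
  smooth : ContDiffOn ℝ ∞ ψ V
  injOn : Set.InjOn ψ V
  immersion : ∀ u ∈ V, Function.Injective (fderiv ℝ ψ u)
  open_image : ∀ O : Set (EuclideanSpace ℝ (Fin d)), O ⊆ V → IsOpen O →
    ∃ O' : Set E, IsOpen O' ∧ ψ '' O = S ∩ O'

/-- The Clarke generalized directional derivative of `f`, read in a chart `φ = ψ⁻¹`, at the point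
`ψ u₀` in the direction `Dψ(u₀) w`:
`limsup_{u → u₀, t ↓ 0} (f (ψ (u + t w)) - f (ψ u)) / t`, where `u = φ y`. -/
def clarkeDirDeriv {d : ℕ} (f : E → ℝ) (ψ : EuclideanSpace ℝ (Fin d) → E)
    (u₀ w : EuclideanSpace ℝ (Fin d)) : EReal :=
  limsup (fun z : EuclideanSpace ℝ (Fin d) × ℝ =>
    (((f (ψ (z.1 + z.2 • w)) - f (ψ z.1)) / z.2 : ℝ) : EReal)) (𝓝 u₀ ×ˢ 𝓝[>] (0 : ℝ))

/-- The Riemannian (Clarke) subdifferential at `x` of the restriction to `S` of `f`: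
all `ξ ∈ T_x S` with `⟪ξ, v⟫ ≤ f°(x; v)` for every `v ∈ T_x S`, where `f°` is computed in a smooth
chart of `S` around `x`; for locally Lipschitz `f` it does not depend on the chart. -/
def riemSubdiff (S : Set E) (f : E → ℝ) (x : E) : Set E :=
  {ξ | ξ ∈ tangentSpaceAt S x ∧
    ∃ (d : ℕ) (V : Set (EuclideanSpace ℝ (Fin d))) (ψ : EuclideanSpace ℝ (Fin d) → E)
      (u₀ : EuclideanSpace ℝ (Fin d)),
      IsInverseChart S V ψ ∧ u₀ ∈ V ∧ ψ u₀ = x ∧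
      ∀ w, ((⟪ξ, fderiv ℝ ψ u₀ w⟫ : ℝ) : EReal) ≤ clarkeDirDeriv f ψ u₀ w}

end Riemannian

namespace SCCA

/-! Matrix norms. -/

/-- The Frobenius inner product. -/
def frobInner {m l : Type*} [Fintype m] [Fintype l] (A B : Matrix m l ℝ) : ℝ :=
  ∑ i, ∑ j, A i j * B i j

/-- The squared Frobenius norm. -/
def frobSq {m l : Type*} [Fintype m] [Fintype l] (A : Matrix m l ℝ) : ℝ := frobInner A A

/-- The nuclear norm: the sum of the singular values. -/
def nuclearNorm {m l : Type*} [Fintype m] [Fintype l] [DecidableEq l] (A : Matrix m l ℝ) : ℝ :=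
  (Matrix.toEuclideanLin A).singularValues.sum fun _ s => s

/-- The largest absolute value of an entry. -/
def maxNorm {m l : Type*} [Fintype m] [Fintype l] (A : Matrix m l ℝ) : ℝ :=
  ‖(fun ij : m × l => A ij.1 ij.2)‖

/-! The problem. -/

/-- The operator `W ↦ (X Diag(W₁), …, X Diag(W_r))`, where `W_i` is the `i`-th column of `W`.
The column `(i, j)` of the result is the `j`-th column of its `i`-th block. -/
def opA {n p r : ℕ} (X : Matrix (Fin n) (Fin p) ℝ) (W : Matrix (Fin p) (Fin r) ℝ) :
    Matrix (Fin n) (Fin r × Fin p) ℝ :=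
  Matrix.of fun a ij => (X * Matrix.diagonal (fun j => W j ij.1)) a ij.2

/-- Positions of the entries of `(U, V, P, Q)`. -/
abbrev Idx (n p q r : ℕ) : Type :=
  (Fin p × Fin r) ⊕ (Fin q × Fin r) ⊕ (Fin n × (Fin r × Fin p)) ⊕ (Fin n × (Fin r × Fin q))

/-- The variable `W = (U, V, P, Q)`, with the Euclidean (Frobenius) inner product. -/
abbrev Var (n p q r : ℕ) : Type := EuclideanSpace ℝ (Idx n p q r)

variable {n p q r : ℕ}

def compU (W : Var n p q r) : Matrix (Fin p) (Fin r) ℝ :=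
  Matrix.of fun i j => W (Sum.inl (i, j))

def compV (W : Var n p q r) : Matrix (Fin q) (Fin r) ℝ :=
  Matrix.of fun i j => W (Sum.inr (Sum.inl (i, j)))

def compP (W : Var n p q r) : Matrix (Fin n) (Fin r × Fin p) ℝ :=
  Matrix.of fun i j => W (Sum.inr (Sum.inr (Sum.inl (i, j))))

def compQ (W : Var n p q r) : Matrix (Fin n) (Fin r × Fin q) ℝ :=
  Matrix.of fun i j => W (Sum.inr (Sum.inr (Sum.inr (i, j))))

/-- The generalized Stiefel manifold `{U | Uᵀ (Xᵀ X) U = I}`. -/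
def stiefel (r : ℕ) (X : Matrix (Fin n) (Fin p) ℝ) : Set (Matrix (Fin p) (Fin r) ℝ) :=
  {U | U.transpose * (X.transpose * X) * U = 1}

/-- The manifold `𝒩 = ℳ₁ × ℳ₂ × ℝ^{n × pr} × ℝ^{n × qr}`. -/
def manifoldN (r : ℕ) (X : Matrix (Fin n) (Fin p) ℝ) (Y : Matrix (Fin n) (Fin q) ℝ) :
    Set (Var n p q r) :=
  {W | compU W ∈ stiefel r X ∧ compV W ∈ stiefel r Y}

/-- The objective `F(W) = ½ ‖X U - Y V‖_F² + λ_u ‖P‖_* + λ_v ‖Q‖_*`. -/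
def objF (X : Matrix (Fin n) (Fin p) ℝ) (Y : Matrix (Fin n) (Fin q) ℝ) (lu lv : ℝ)
    (W : Var n p q r) : ℝ :=
  1 / 2 * frobSq (X * compU W - Y * compV W)
    + lu * nuclearNorm (compP W) + lv * nuclearNorm (compQ W)

/-- First constraint block `A_X(U) - P`. -/
def h₁ (X : Matrix (Fin n) (Fin p) ℝ) (W : Var n p q r) : Matrix (Fin n) (Fin r × Fin p) ℝ :=
  opA X (compU W) - compP W

/-- Second constraint block `A_Y(V) - Q`. -/
def h₂ (Y : Matrix (Fin n) (Fin q) ℝ) (W : Var n p q r) : Matrix (Fin n) (Fin r × Fin q) ℝ :=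
  opA Y (compV W) - compQ W

/-- The augmented Lagrangian `ℒ_ρ(W; Λ₁, Λ₂)`. -/
def augLagrangian (X : Matrix (Fin n) (Fin p) ℝ) (Y : Matrix (Fin n) (Fin q) ℝ) (lu lv : ℝ)
    (rho : ℝ) (L₁ : Matrix (Fin n) (Fin r × Fin p) ℝ) (L₂ : Matrix (Fin n) (Fin r × Fin q) ℝ)
    (W : Var n p q r) : ℝ :=
  objF X Y lu lv W - frobInner L₁ (h₁ X W) - frobInner L₂ (h₂ Y W)
    + rho / 2 * frobSq (h₁ X W) + rho / 2 * frobSq (h₂ Y W)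

/-- The sequences `W^k = (U^k, V^k, P^k, Q^k)`, `Λ₁^k`, `Λ₂^k`, `ρ_k` are generated by the manifold
inexact augmented Lagrangian method with tolerances `ε_k`, contraction factor `τ` and penalty
growth factor `γ`. The residuals are `R₁^k = h₁(W^{k+1})` and `R₂^k = h₂(W^{k+1})`. -/
structure IsGenerated (X : Matrix (Fin n) (Fin p) ℝ) (Y : Matrix (Fin n) (Fin q) ℝ)
    (lu lv τ γ : ℝ) (ε : ℕ → ℝ) (W : ℕ → Var n p q r)
    (L₁ : ℕ → Matrix (Fin n) (Fin r × Fin p) ℝ) (L₂ : ℕ → Matrix (Fin n) (Fin r × Fin q) ℝ)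
    (rho : ℕ → ℝ) : Prop where
  mem : ∀ k, W k ∈ manifoldN r X Y
  /-- the subproblem is solved up to a Riemannian subgradient of norm at most `ε_k` -/
  stopping : ∀ k, ∃ δ ∈ riemSubdiff (manifoldN r X Y)
    (augLagrangian X Y lu lv (rho k) (L₁ k) (L₂ k)) (W (k + 1)), ‖δ‖ ≤ ε k
  dual₁ : ∀ k, L₁ (k + 1) = L₁ k - rho k • h₁ X (W (k + 1))
  dual₂ : ∀ k, L₂ (k + 1) = L₂ k - rho k • h₂ Y (W (k + 1))
  penalty_keep : ∀ k,
    (maxNorm (h₁ X (W (k + 1))) ≤ τ * maxNorm (h₁ X (W k)) ∧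
      maxNorm (h₂ Y (W (k + 1))) ≤ τ * maxNorm (h₂ Y (W k))) → rho (k + 1) = rho k
  penalty_grow : ∀ k,
    ¬ (maxNorm (h₁ X (W (k + 1))) ≤ τ * maxNorm (h₁ X (W k)) ∧
      maxNorm (h₂ Y (W (k + 1))) ≤ τ * maxNorm (h₂ Y (W k))) → rho (k + 1) = γ * rho k

/-- `grad [h₁(W)]_{ij}` on `𝒩`. -/
def gradH₁ (X : Matrix (Fin n) (Fin p) ℝ) (Y : Matrix (Fin n) (Fin q) ℝ) (W : Var n p q r)
    (ij : Fin n × (Fin r × Fin p)) : Var n p q r :=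
  riemGrad (manifoldN r X Y) (fun W' => h₁ X W' ij.1 ij.2) W

/-- `grad [h₂(W)]_{ij}` on `𝒩`. -/
def gradH₂ (X : Matrix (Fin n) (Fin p) ℝ) (Y : Matrix (Fin n) (Fin q) ℝ) (W : Var n p q r)
    (ij : Fin n × (Fin r × Fin q)) : Var n p q r :=
  riemGrad (manifoldN r X Y) (fun W' => h₂ Y W' ij.1 ij.2) W

/-- LICQ at `W`: the Riemannian gradients of all components of `h` are linearly independent. -/
def LICQ (X : Matrix (Fin n) (Fin p) ℝ) (Y : Matrix (Fin n) (Fin q) ℝ) (W : Var n p q r) : Prop :=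
  LinearIndependent ℝ (Sum.elim (gradH₁ X Y W) (gradH₂ X Y W))

/-- `W` is a KKT point of `min F(W)` subject to `h(W) = 0`, `W ∈ 𝒩`: it is feasible and, for some
multipliers `Z`, `0 ∈ ∂F(W) + ∑ Z_{ij} grad [h(W)]_{ij}`. -/
def IsKKT (X : Matrix (Fin n) (Fin p) ℝ) (Y : Matrix (Fin n) (Fin q) ℝ) (lu lv : ℝ)
    (W : Var n p q r) : Prop :=
  W ∈ manifoldN r X Y ∧ h₁ X W = 0 ∧ h₂ Y W = 0 ∧
  ∃ (Z₁ : Matrix (Fin n) (Fin r × Fin p) ℝ) (Z₂ : Matrix (Fin n) (Fin r × Fin q) ℝ),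
    ∃ ξ ∈ riemSubdiff (manifoldN r X Y) (objF X Y lu lv) W,
      ξ + (∑ i, ∑ j, Z₁ i j • gradH₁ X Y W (i, j))
        + (∑ i, ∑ j, Z₂ i j • gradH₂ X Y W (i, j)) = 0

end SCCA

end

/-! The nonsmooth part `c` of the objective is a seminorm, because the nuclear norm is a maximum of
linear functionals (`sum_inner_le_sum_singularValues`, `exists_sum_inner_eq_sum_singularValues`).
For a smooth `g` plus such a `c`, membership `ξ ∈ ∂(g + c)(x)` on a manifold amounts to the convex
inequality `⟪ξ, v⟫ ≤ g' v + c (x + v) - c x` for all tangent `v` (`inner_le_of_mem_riemSubdiff`,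
`mem_riemSubdiff_of_inner_le`). This inequality passes to limits, whereas the Clarke definition is
awkward to handle directly.

By the multiplier update, the derivative of the smooth part of the augmented Lagrangian at `W (k +
1)` is that of the ordinary Lagrangian at the updated multipliers. So each iterate satisfies the
convex inequality up to `ε k * ‖v‖` (`IsGenerated.le_lagrangian`). The blocks `P` and `Q` are
unconstrained in `𝒩`: testing with directions `±v` in these blocks bounds every entry of the
multipliers (`IsGenerated.abs_multiplier_le`).

Bounded multipliers force feasibility in the limit. If the penalties diverge, the residual is a
bounded difference of multipliers divided by `rho k`; otherwise the residual eventually contracts by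
`τ` at each step (`IsGenerated.tendsto_residual`). The Stiefel blocks are bounded, and `P`, `Q`
differ from linear images of them by the residuals, so limit points exist. Along an ultrafilter
converging to a limit point the multipliers converge too. Tangent vectors there are limits of
tangent vectors at the iterates (`IsInverseChart.exists_tendsto_tangent`), so the inequality
survives in the limit and is the KKT condition. -/

noncomputable section

/-! ### Singular values and the duality formula for the nuclear norm. -/

section SingularValues

variable {E : Type*} [NormedAddCommGroup E] [InnerProductSpace ℝ E] [FiniteDimensional ℝ E]
  {F : Type*} [NormedAddCommGroup F] [InnerProductSpace ℝ F]

/-- A pairwise orthogonal family in the closed unit ball. -/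
def OrthogonalContraction {ι : Type*} (f : ι → F) : Prop :=
  (∀ i j, i ≠ j → ⟪f i, f j⟫ = 0) ∧ ∀ i, ⟪f i, f i⟫ ≤ 1

theorem OrthogonalContraction.norm_sum_smul_sq_le {ι : Type*} [Fintype ι] {f : ι → F}
    (hf : OrthogonalContraction f) (c : ι → ℝ) : ‖∑ i, c i • f i‖ ^ 2 ≤ ∑ i, c i ^ 2 := by
  rw [← real_inner_self_eq_norm_sq, sum_inner]
  refine Finset.sum_le_sum fun i _ => ?_
  simp only [inner_sum, real_inner_smul_left, real_inner_smul_right]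
  rw [Finset.sum_eq_single i]
  · nlinarith [hf.2 i, sq_nonneg (c i)]
  · intro j _ hj
    simp [hf.1 i j hj.symm]
  · simp

variable [FiniteDimensional ℝ F]

/-- Eigenvectors of `T* T` form an orthonormal basis on which `T` acts by singular values. -/
theorem exists_orthonormalBasis_inner_map (T : E →ₗ[ℝ] F) :
    ∃ e : OrthonormalBasis (Fin (Module.finrank ℝ E)) ℝ E,
      ∀ i j, ⟪T (e i), T (e j)⟫ = if i = j then T.singularValues i ^ 2 else 0 := by
  refine ⟨T.isSymmetric_adjoint_comp_self.eigenvectorBasis rfl, fun i j => ?_⟩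
  have h := T.isSymmetric_adjoint_comp_self.apply_eigenvectorBasis rfl j
  rw [← LinearMap.adjoint_inner_right, ← LinearMap.comp_apply, h, inner_smul_right,
    OrthonormalBasis.inner_eq_ite]
  split_ifs with hij
  · subst hij
    rw [T.sq_singularValues_fin rfl]
    simp
  · simp

theorem sum_singularValues_eq (T : E →ₗ[ℝ] F) :
    (T.singularValues.sum fun _ s => s) =
      ∑ i : Fin (Module.finrank ℝ E), T.singularValues i := by
  rw [Finsupp.sum_of_support_subset (s := Finset.range (Module.finrank ℝ E)), Finset.sum_range]
  · intro i hi
    by_contra h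
    rw [Finset.mem_range, not_lt] at h
    exact Finsupp.mem_support_iff.1 hi (T.singularValues_of_finrank_le h)
  · simp

/-- The left side is the trace of `K* T`, where `K` sends `e i` to `f i` and is a contraction. A
trace can be computed in any orthonormal basis; in the singular basis of `T` each diagonal term is
at most one singular value by Cauchy-Schwarz. -/
theorem sum_inner_le_sum_singularValues {ι : Type*} [Fintype ι] (T : E →ₗ[ℝ] F)
    (e : OrthonormalBasis ι ℝ E) {f : ι → F} (hf : OrthogonalContraction f) :
    ∑ i, ⟪T (e i), f i⟫ ≤ T.singularValues.sum fun _ s => s := by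
  obtain ⟨a, ha⟩ := exists_orthonormalBasis_inner_map T
  have hnorm : ∀ j, ‖T (a j)‖ = T.singularValues j := fun j => by
    have h := ha j j
    rw [real_inner_self_eq_norm_sq, if_pos rfl] at h
    exact (sq_eq_sq₀ (norm_nonneg _) (T.singularValues_nonneg _)).1 h
  have hexp : ∑ i, ⟪T (e i), f i⟫ = ∑ j, ⟪T (a j), ∑ i, ⟪a j, e i⟫ • f i⟫ := by
    simp_rw [inner_sum]
    rw [Finset.sum_comm]
    refine Finset.sum_congr rfl fun i _ => ?_
    conv_lhs => rw [← a.sum_repr' (e i)]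
    simp [sum_inner, inner_smul_left, inner_smul_right]
  rw [hexp, sum_singularValues_eq]
  refine Finset.sum_le_sum fun j _ => ?_
  -- The coefficients are the coordinates of the unit vector `a j` in the basis `e`.
  have h1 : ‖∑ i, ⟪a j, e i⟫ • f i‖ ≤ 1 := by
    have h2 := hf.norm_sum_smul_sq_le fun i => ⟪a j, e i⟫
    have h3 : ∑ i, ⟪a j, e i⟫ ^ 2 = 1 := by
      have := e.sum_sq_inner_left (a j)
      simpa [real_inner_comm] using this
    rw [h3] at h2
    exact (sq_le_one_iff₀ (norm_nonneg _)).1 h2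
  calc ⟪T (a j), ∑ i, ⟪a j, e i⟫ • f i⟫
      ≤ ‖T (a j)‖ * ‖∑ i, ⟪a j, e i⟫ • f i‖ := real_inner_le_norm _ _
    _ ≤ ‖T (a j)‖ * 1 := by gcongr
    _ = T.singularValues j := by rw [mul_one, hnorm]

/-- Polar decomposition: the maximizer is the partial isometry that normalizes the vectors `T (e
i)`. -/
theorem exists_sum_inner_eq_sum_singularValues (T : E →ₗ[ℝ] F) :
    ∃ (e : OrthonormalBasis (Fin (Module.finrank ℝ E)) ℝ E)
      (f : Fin (Module.finrank ℝ E) → F), OrthogonalContraction f ∧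
      (T.singularValues.sum fun _ s => s) = ∑ i, ⟪T (e i), f i⟫ := by
  obtain ⟨e, he⟩ := exists_orthonormalBasis_inner_map T
  -- Since `0⁻¹ = 0`, a vanishing singular value yields the zero vector; hence families in the unit
  -- ball rather than orthonormal ones.
  refine ⟨e, fun i => (T.singularValues i)⁻¹ • T (e i), ⟨fun i j hij => ?_, fun i => ?_⟩, ?_⟩
  · simp [real_inner_smul_left, real_inner_smul_right, he, hij]
  · simp only [real_inner_smul_left, real_inner_smul_right, he, if_true]
    by_cases hi : T.singularValues i = 0
    · simp [hi]
    · field_simp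
      exact le_refl _
  · rw [sum_singularValues_eq]
    refine Finset.sum_congr rfl fun i _ => ?_
    simp only [inner_smul_right, he, if_true]
    by_cases hi : T.singularValues i = 0
    · simp [hi]
    · field_simp

/-- The functional that is optimal for `S + T` is admissible for `S` and for `T`. -/
theorem sum_singularValues_add_le (S T : E →ₗ[ℝ] F) :
    ((S + T).singularValues.sum fun _ s => s) ≤
      (S.singularValues.sum fun _ s => s) + T.singularValues.sum fun _ s => s := by
  obtain ⟨e, f, hf, h⟩ := exists_sum_inner_eq_sum_singularValues (S + T)
  rw [h]
  simp only [LinearMap.add_apply, inner_add_left, Finset.sum_add_distrib]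
  exact add_le_add (sum_inner_le_sum_singularValues S e hf) (sum_inner_le_sum_singularValues T e hf)

theorem sum_singularValues_smul_le (r : ℝ) (T : E →ₗ[ℝ] F) :
    ((r • T).singularValues.sum fun _ s => s) ≤ ‖r‖ * T.singularValues.sum fun _ s => s := by
  obtain ⟨e, f, hf, h⟩ := exists_sum_inner_eq_sum_singularValues (r • T)
  -- `s` is a sign of `r`, to be absorbed into the family `f`.
  obtain ⟨s, hs, hr⟩ : ∃ s : ℝ, s * s = 1 ∧ r = ‖r‖ * s := by
    rcases le_total 0 r with h0 | h0
    · exact ⟨1, by norm_num, by simp [abs_of_nonneg h0]⟩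
    · exact ⟨-1, by norm_num, by simp [abs_of_nonpos h0]⟩
  have hf' : OrthogonalContraction fun i => s • f i := by
    refine ⟨fun i j hij => ?_, fun i => ?_⟩ <;>
      simp only [real_inner_smul_left, real_inner_smul_right]
    · simp [hf.1 i j hij]
    · rw [← mul_assoc, hs, one_mul]
      exact hf.2 i
  rw [h]
  calc ∑ i, ⟪(r • T) (e i), f i⟫ = ‖r‖ * ∑ i, ⟪T (e i), s • f i⟫ := by
        rw [Finset.mul_sum]
        refine Finset.sum_congr rfl fun i _ => ?_
        rw [LinearMap.smul_apply, inner_smul_left, inner_smul_right]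
        conv_lhs => rw [hr]
        simp [mul_assoc]
    _ ≤ _ := by
        gcongr
        exact sum_inner_le_sum_singularValues T e hf'

end SingularValues

namespace SCCA

/-- The nuclear norm as a seminorm. -/
def nuclearSeminorm (m l : Type*) [Fintype m] [Fintype l] [DecidableEq l] :
    Seminorm ℝ (Matrix m l ℝ) :=
  Seminorm.ofSMulLE nuclearNorm
    (by simp [nuclearNorm])
    (fun A B => by
      simp only [nuclearNorm, map_add]
      exact sum_singularValues_add_le _ _)
    (fun r A => by
      simp only [nuclearNorm, map_smul]
      exact sum_singularValues_smul_le _ _)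

end SCCA

/-! ### Charts, tangent spaces, and convergence of tangent vectors. -/

section Charts

variable {E : Type*} [NormedAddCommGroup E] [InnerProductSpace ℝ E]
  {S : Set E} {d : ℕ} {V : Set (EuclideanSpace ℝ (Fin d))} {ψ : EuclideanSpace ℝ (Fin d) → E}
  {u₀ : EuclideanSpace ℝ (Fin d)}

theorem IsInverseChart.contDiffAt (h : IsInverseChart S V ψ) {u : EuclideanSpace ℝ (Fin d)}
    (hu : u ∈ V) : ContDiffAt ℝ ∞ ψ u :=
  h.smooth.contDiffAt (h.isOpen.mem_nhds hu)

theorem IsInverseChart.hasStrictFDerivAt (h : IsInverseChart S V ψ)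
    {u : EuclideanSpace ℝ (Fin d)} (hu : u ∈ V) : HasStrictFDerivAt ψ (fderiv ℝ ψ u) u :=
  (h.contDiffAt hu).hasStrictFDerivAt (by simp)

theorem IsInverseChart.mem (h : IsInverseChart S V ψ) {u : EuclideanSpace ℝ (Fin d)}
    (hu : u ∈ V) : ψ u ∈ S := by
  obtain ⟨O', -, hO⟩ := h.open_image V subset_rfl h.isOpen
  exact (hO.subset (Set.mem_image_of_mem ψ hu)).1

variable [FiniteDimensional ℝ E]

/-- The chart `φ = ψ⁻¹` extends to a map of the ambient space differentiable at the base point. -/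
theorem IsInverseChart.exists_extension (h : IsInverseChart S V ψ) (hu₀ : u₀ ∈ V) :
    ∃ (φ : E → EuclideanSpace ℝ (Fin d)) (B : E →L[ℝ] EuclideanSpace ℝ (Fin d)),
      HasFDerivAt φ B (ψ u₀) ∧ φ (ψ u₀) = u₀ ∧ ∀ᶠ x in 𝓝[S] (ψ u₀), φ x ∈ V ∧ ψ (φ x) = x := by
  -- With `B` a linear left inverse of `Dψ(u₀)`, the map `B ∘ ψ` has derivative the identity at
  -- `u₀`. Its local inverse, precomposed with `B`, is the extension.
  obtain ⟨B, hB⟩ := LinearMap.exists_leftInverse_of_injective (fderiv ℝ ψ u₀).toLinearMap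
    (LinearMap.ker_eq_bot.2 (h.immersion u₀ hu₀))
  set B' : E →L[ℝ] EuclideanSpace ℝ (Fin d) := B.toContinuousLinearMap with hB'
  have hcomp : HasStrictFDerivAt (fun u => B' (ψ u))
      ((ContinuousLinearEquiv.refl ℝ (EuclideanSpace ℝ (Fin d)) :
        EuclideanSpace ℝ (Fin d) →L[ℝ] EuclideanSpace ℝ (Fin d))) u₀ := by
    have := B'.hasStrictFDerivAt.comp u₀ (h.hasStrictFDerivAt hu₀)
    convert! this using 1
    ext1 w
    exact (LinearMap.congr_fun hB w).symm
  have hleft := hcomp.eventually_left_inverse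
  have hinv := hcomp.to_localInverse.hasFDerivAt
  set θ := hcomp.localInverse _ _ _
  refine ⟨fun x => θ (B' x), _, hinv.comp (ψ u₀) B'.hasFDerivAt, hleft.self_of_nhds, ?_⟩
  -- Relative openness of `ψ '' O` ensures that every point of `S` near `ψ u₀` has a preimage near
  -- `u₀`, where the local inverse is valid.
  obtain ⟨O, hO, hOo, hu₀O⟩ := eventually_nhds_iff.1 (hleft.and (h.isOpen.mem_nhds hu₀))
  obtain ⟨O', hO'o, hO'⟩ := h.open_image O (fun u hu => (hO u hu).2) hOo
  have hmem : ψ u₀ ∈ O' := (hO'.subset (Set.mem_image_of_mem ψ hu₀O)).2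
  filter_upwards [self_mem_nhdsWithin, mem_nhdsWithin_of_mem_nhds (hO'o.mem_nhds hmem)]
    with x hxS hxO
  obtain ⟨u, hu, rfl⟩ := hO'.superset ⟨hxS, hxO⟩
  rw [(hO u hu).1]
  exact ⟨(hO u hu).2, rfl⟩

/-- Images of straight lines under `ψ` are curves in `S`; conversely a curve in `S` factors through
`ψ` by the differentiable extension of the chart. -/
theorem IsInverseChart.range_fderiv (h : IsInverseChart S V ψ) (hu₀ : u₀ ∈ V) :
    (fderiv ℝ ψ u₀).range = tangentSpaceAt S (ψ u₀) := by
  apply le_antisymm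
  · rintro _ ⟨w, rfl⟩
    apply Submodule.subset_span
    have hline : ContDiffAt ℝ ∞ (fun t : ℝ => u₀ + t • w) 0 := by fun_prop
    have hψ : ContDiffAt ℝ ∞ ψ (u₀ + (0 : ℝ) • w) := by simpa using h.contDiffAt hu₀
    refine ⟨fun t => ψ (u₀ + t • w), hψ.comp (0 : ℝ) hline, by simp, ?_, ?_⟩
    · have : Tendsto (fun t : ℝ => u₀ + t • w) (𝓝 0) (𝓝 u₀) := by
        simpa using hline.continuousAt.tendsto
      filter_upwards [this.eventually (h.isOpen.mem_nhds hu₀)] with t ht using h.mem ht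
    · have hd : HasDerivAt (fun t : ℝ => u₀ + t • w) w 0 := by
        simpa using ((hasDerivAt_id (0 : ℝ)).smul_const w).const_add u₀
      have hf : HasFDerivAt ψ (fderiv ℝ ψ u₀) (u₀ + (0 : ℝ) • w) := by
        simpa using (h.hasStrictFDerivAt hu₀).hasFDerivAt
      exact hf.comp_hasDerivAt (0 : ℝ) hd
  · refine Submodule.span_le.2 ?_
    rintro v ⟨γ, -, hγ0, hγS, hγ⟩
    obtain ⟨φ, B, hφ, hφ0, hψφ⟩ := h.exists_extension hu₀
    have htend : Tendsto γ (𝓝 0) (𝓝[S] (ψ u₀)) :=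
      tendsto_nhdsWithin_iff.2 ⟨hγ0 ▸ hγ.continuousAt.tendsto, hγS⟩
    have hev : γ =ᶠ[𝓝 0] fun t => ψ (φ (γ t)) := by
      filter_upwards [htend.eventually hψφ] with t ht using ht.2.symm
    have h1 : HasDerivAt (fun t => φ (γ t)) (B v) 0 := by
      rw [← hγ0] at hφ
      exact hφ.comp_hasDerivAt (0 : ℝ) hγ
    have h2 : HasDerivAt (fun t => ψ (φ (γ t))) (fderiv ℝ ψ u₀ (B v)) 0 := by
      have h3 : HasFDerivAt ψ (fderiv ℝ ψ u₀) (φ (γ 0)) := by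
        rw [hγ0, hφ0]
        exact (h.hasStrictFDerivAt hu₀).hasFDerivAt
      exact h3.comp_hasDerivAt (0 : ℝ) h1
    exact ⟨B v, (h2.congr_of_eventuallyEq hev).unique hγ⟩

/-- Tangent vectors at `ψ u₀` are limits of tangent vectors at points that converge to `ψ u₀`. -/
theorem IsInverseChart.exists_tendsto_tangent (h : IsInverseChart S V ψ) (hu₀ : u₀ ∈ V)
    {ι : Type*} {l : Filter ι} {x : ι → E} (hx : Tendsto x l (𝓝 (ψ u₀)))
    (hxS : ∀ᶠ i in l, x i ∈ S) {v : E} (hv : v ∈ tangentSpaceAt S (ψ u₀)) :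
    ∃ v' : ι → E, Tendsto v' l (𝓝 v) ∧ ∀ᶠ i in l, v' i ∈ tangentSpaceAt S (x i) := by
  rw [← h.range_fderiv hu₀] at hv
  obtain ⟨w, rfl⟩ := hv
  obtain ⟨φ, B, hφ, hφ0, hψφ⟩ := h.exists_extension hu₀
  -- Keep the coordinate vector `w` fixed and push it forward at the moving base point.
  refine ⟨fun i => fderiv ℝ ψ (φ (x i)) w, ?_, ?_⟩
  · have h1 : Tendsto (fun i => φ (x i)) l (𝓝 u₀) := hφ0 ▸ hφ.continuousAt.tendsto.comp hx
    have h2 : ContinuousAt (fderiv ℝ ψ) u₀ :=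
      ((h.contDiffAt hu₀).fderiv_right (m := 0) (by simp)).continuousAt
    exact ((ContinuousLinearMap.apply ℝ E w).continuous.tendsto _).comp (h2.tendsto.comp h1)
  · filter_upwards [(tendsto_nhdsWithin_iff.2 ⟨hx, hxS⟩).eventually hψφ] with i hi
    have := h.range_fderiv hi.1
    rw [hi.2] at this
    exact this.le ⟨w, rfl⟩

end Charts

/-! ### Difference quotients with a moving base point. -/

section Slopes

variable {E F : Type*} [NormedAddCommGroup E] [NormedSpace ℝ E] [NormedAddCommGroup F]
  [NormedSpace ℝ F]

theorem HasStrictFDerivAt.tendsto_slope {f : E → F} {f' : E →L[ℝ] F} {x : E}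
    (hf : HasStrictFDerivAt f f' x) (w : E) :
    Tendsto (fun z : E × ℝ => z.2⁻¹ • (f (z.1 + z.2 • w) - f z.1)) (𝓝 x ×ˢ 𝓝[>] (0 : ℝ))
      (𝓝 (f' w)) := by
  have h1 : Tendsto (fun z : E × ℝ => (z.1 + z.2 • w, z.1)) (𝓝 x ×ˢ 𝓝[>] (0 : ℝ))
      (𝓝 (x, x)) := by
    have : Tendsto (fun z : E × ℝ => (z.1 + z.2 • w, z.1)) (𝓝 (x, (0 : ℝ)))
        (𝓝 (x + (0 : ℝ) • w, x)) :=
      Continuous.tendsto (by fun_prop) _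
    rw [zero_smul, add_zero] at this
    refine this.mono_left ?_
    rw [nhds_prod_eq]
    exact Filter.prod_mono le_rfl nhdsWithin_le_nhds
  have h2 := (hasStrictFDerivAt_iff_isLittleO.1 hf).comp_tendsto h1
  have h3 : (fun z : E × ℝ => z.2⁻¹ • (f (z.1 + z.2 • w) - f z.1) - f' w)
      =o[𝓝 x ×ˢ 𝓝[>] (0 : ℝ)] fun z => z.2⁻¹ • (z.2 • w) := by
    refine ((Asymptotics.isBigO_refl (fun z : E × ℝ => z.2⁻¹) _).smul_isLittleO h2).congr' ?_ ?_
    · have : ∀ᶠ z : E × ℝ in 𝓝 x ×ˢ 𝓝[>] (0 : ℝ), 0 < z.2 :=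
        tendsto_snd.eventually self_mem_nhdsWithin
      filter_upwards [this] with z hz
      simp [smul_sub, smul_smul, inv_mul_cancel₀ hz.ne']
    · exact Eventually.of_forall fun z => by simp
  have h4 : (fun z : E × ℝ => z.2⁻¹ • (z.2 • w)) =O[𝓝 x ×ˢ 𝓝[>] (0 : ℝ)] fun _ => (1 : ℝ) := by
    refine Asymptotics.IsBigO.of_bound ‖w‖ (Eventually.of_forall fun z => ?_)
    by_cases hz : z.2 = 0
    · simp [hz]
    · simp [smul_smul, inv_mul_cancel₀ hz]
  exact tendsto_sub_nhds_zero_iff.1 ((Asymptotics.isLittleO_one_iff ℝ).1 (h3.trans_isBigO h4))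

end Slopes

/-! ### Clarke subgradients of a smooth function plus a seminorm. -/

section Subdifferential

variable {E : Type*} [NormedAddCommGroup E] [InnerProductSpace ℝ E] [FiniteDimensional ℝ E]
  {S : Set E} {g : E → ℝ} {g' : E →L[ℝ] ℝ} {c : Seminorm ℝ E} {x ξ : E}

/-- A Clarke subgradient of a smooth function plus a seminorm satisfies the convex subgradient
inequality along tangent vectors. -/
theorem inner_le_of_mem_riemSubdiff (hg : HasStrictFDerivAt g g' x) (hc : Continuous c)
    (hξ : ξ ∈ riemSubdiff S (fun y => g y + c y) x) {v : E} (hv : v ∈ tangentSpaceAt S x) :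
    ⟪ξ, v⟫ ≤ g' v + (c (x + v) - c x) := by
  obtain ⟨-, d, V, ψ, u₀, hψ, hu₀, rfl, h⟩ := hξ
  rw [← hψ.range_fderiv hu₀] at hv
  obtain ⟨w, rfl⟩ := hv
  have hψ' := hψ.hasStrictFDerivAt hu₀
  set v := fderiv ℝ ψ u₀ w
  have hs1 := hψ'.tendsto_slope w
  have hs2 := (hg.comp u₀ hψ').tendsto_slope w
  have hψc : Tendsto (fun z : EuclideanSpace ℝ (Fin d) × ℝ => ψ z.1) (𝓝 u₀ ×ˢ 𝓝[>] (0 : ℝ))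
      (𝓝 (ψ u₀)) := (hψ.contDiffAt hu₀).continuousAt.tendsto.comp tendsto_fst
  -- By convexity, for `0 < t < 1` the quotient of `c` between `y` and `y + t • q` is at most `c (y
  -- + q) - c y`. This bound converges, since `q` tends to `v`.
  have hb := hs2.add (((hc.tendsto _).comp (hψc.add hs1)).sub ((hc.tendsto _).comp hψc))
  have hb' := (continuous_coe_real_ereal.tendsto _).comp hb
  rw [← EReal.coe_le_coe_iff]
  refine (h w).trans (le_trans ?_ hb'.limsup_eq.le)
  refine limsup_le_limsup ?_
  have h1 : ∀ᶠ z : EuclideanSpace ℝ (Fin d) × ℝ in 𝓝 u₀ ×ˢ 𝓝[>] (0 : ℝ),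
      z.2 ∈ Set.Ioo (0 : ℝ) 1 :=
    tendsto_snd.eventually (Ioo_mem_nhdsGT one_pos)
  filter_upwards [h1] with z hz
  simp only [Function.comp_apply, EReal.coe_le_coe_iff]
  obtain ⟨hz0, hz1⟩ := hz
  set y := ψ z.1
  set q := z.2⁻¹ • (ψ (z.1 + z.2 • w) - y) with hq
  have hy : ψ (z.1 + z.2 • w) = (1 - z.2) • y + z.2 • (y + q) := by
    rw [hq, smul_add, smul_smul, mul_inv_cancel₀ hz0.ne']
    module
  have hconv : c (ψ (z.1 + z.2 • w)) ≤ (1 - z.2) * c y + z.2 * c (y + q) := by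
    rw [hy]
    refine (map_add_le_add c _ _).trans_eq ?_
    rw [map_smul_eq_mul, map_smul_eq_mul, Real.norm_of_nonneg hz0.le,
      Real.norm_of_nonneg (by linarith)]
  rw [div_le_iff₀ hz0, smul_eq_mul]
  have : z.2⁻¹ * (g (ψ (z.1 + z.2 • w)) - g y) * z.2 = g (ψ (z.1 + z.2 • w)) - g y := by
    field_simp
  rw [add_mul, this]
  linarith

/-- The limsup is bounded below by freezing the base point at `u₀`. The hypothesis at `t • v`
handles the tangent step, and its distance to the curve is `o(t)`, which a continuous seminorm does
not see after division by `t`. -/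
theorem mem_riemSubdiff_of_inner_le {d : ℕ} {V : Set (EuclideanSpace ℝ (Fin d))}
    {ψ : EuclideanSpace ℝ (Fin d) → E} {u₀ : EuclideanSpace ℝ (Fin d)}
    (hψ : IsInverseChart S V ψ) (hu₀ : u₀ ∈ V) (hx : ψ u₀ = x)
    (hg : HasStrictFDerivAt g g' x) (hc : Continuous c) (hξ : ξ ∈ tangentSpaceAt S x)
    (h : ∀ v ∈ tangentSpaceAt S x, ⟪ξ, v⟫ ≤ g' v + (c (x + v) - c x)) :
    ξ ∈ riemSubdiff S (fun y => g y + c y) x := by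
  subst hx
  refine ⟨hξ, d, V, ψ, u₀, hψ, hu₀, rfl, fun w => ?_⟩
  have hψ' := hψ.hasStrictFDerivAt hu₀
  set v := fderiv ℝ ψ u₀ w with hvdef
  have hv : v ∈ tangentSpaceAt S (ψ u₀) := hψ.range_fderiv hu₀ ▸ ⟨w, rfl⟩
  have hl : Tendsto (fun t : ℝ => (u₀, t)) (𝓝[>] 0) (𝓝 u₀ ×ˢ 𝓝[>] (0 : ℝ)) :=
    tendsto_const_nhds.prodMk tendsto_id
  have hs1 := (hψ'.tendsto_slope w).comp hl
  have hs2 := ((hg.comp u₀ hψ').tendsto_slope w).comp hl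
  have hc0 := (hc.tendsto _).comp ((tendsto_const_nhds (x := v)).sub hs1)
  have hb := (hs2.add_const (⟪ξ, v⟫ - g' v)).sub hc0
  have hlim : (g'.comp (fderiv ℝ ψ u₀)) w + (⟪ξ, v⟫ - g' v) - c (v - fderiv ℝ ψ u₀ w)
      = ⟪ξ, v⟫ := by simp [← hvdef]
  rw [hlim] at hb
  have hb' := (continuous_coe_real_ereal.tendsto _).comp hb
  refine hb'.limsup_eq.ge.trans ?_
  refine le_trans ?_ (limsup_le_limsup_of_le (f := map (fun t : ℝ => (u₀, t)) (𝓝[>] 0)) hl)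
  rw [← Filter.limsup_comp]
  refine limsup_le_limsup ?_
  filter_upwards [self_mem_nhdsWithin] with t ht
  have ht0 : (0 : ℝ) < t := ht
  simp only [Function.comp_apply, EReal.coe_le_coe_iff]
  set q := t⁻¹ • (ψ (u₀ + t • w) - ψ u₀) with hq
  have h1 := h (t • v) (Submodule.smul_mem _ _ hv)
  rw [inner_smul_right, map_smul, smul_eq_mul] at h1
  have hy : ψ u₀ + t • v = ψ (u₀ + t • w) + t • (v - q) := by
    rw [hq, smul_sub, smul_smul, mul_inv_cancel₀ ht0.ne']
    module
  have h2 : c (ψ u₀ + t • v) ≤ c (ψ (u₀ + t • w)) + t * c (v - q) := by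
    rw [hy]
    refine (map_add_le_add c _ _).trans_eq ?_
    rw [map_smul_eq_mul, Real.norm_of_nonneg ht0.le]
  rw [le_div_iff₀ ht0, smul_eq_mul]
  have : t⁻¹ * (g (ψ (u₀ + t • w)) - g (ψ u₀)) * t = g (ψ (u₀ + t • w)) - g (ψ u₀) := by
    field_simp
  rw [sub_mul, add_mul, this]
  linarith

end Subdifferential

/-! ### Charts of regular level sets. -/

section LevelSets

variable {E : Type*} [NormedAddCommGroup E] [InnerProductSpace ℝ E] [FiniteDimensional ℝ E]
  {F : Type*} [NormedAddCommGroup F] [NormedSpace ℝ F]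

/-- A regular level set has a smooth chart around each of its points. -/
theorem exists_isInverseChart_levelSet {Φ : E → F} (hΦ : ContDiff ℝ ∞ Φ) {x : E} (hx : Φ x = 0)
    (hsurj : Function.Surjective (fderiv ℝ Φ x)) :
    ∃ (d : ℕ) (V : Set (EuclideanSpace ℝ (Fin d))) (ψ : EuclideanSpace ℝ (Fin d) → E)
      (u₀ : EuclideanSpace ℝ (Fin d)),
      IsInverseChart {y | Φ y = 0} V ψ ∧ u₀ ∈ V ∧ ψ u₀ = x := by
  have : CompleteSpace E := FiniteDimensional.complete ℝ E
  set A := fderiv ℝ Φ x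
  set K : Submodule ℝ E := A.ker
  set L := (stdOrthonormalBasis ℝ K).repr.symm
  set d := Module.finrank ℝ K
  set π : E →L[ℝ] EuclideanSpace ℝ (Fin d) :=
    (L.symm.toContinuousLinearEquiv : K →L[ℝ] EuclideanSpace ℝ (Fin d)).comp K.orthogonalProjectionOnto
  -- Adding coordinates on the kernel of `DΦ(x)` makes the derivative bijective. The chart is the
  -- local inverse of `G` restricted to the slice `(0, u)`.
  set G : E → F × EuclideanSpace ℝ (Fin d) := fun y => (Φ y, π y) with hGdef
  have hG : ContDiff ℝ ∞ G := hΦ.prodMk π.contDiff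
  have hGd : HasFDerivAt G (A.prod π) x :=
    ((hΦ.differentiable (by simp)).differentiableAt.hasFDerivAt).prodMk π.hasFDerivAt
  have hπL : ∀ u, π (L u) = u := fun u => by simp [π]
  have hbij : Function.Bijective (A.prod π) := by
    refine ⟨(injective_iff_map_eq_zero _).2 fun v hv => ?_, fun ⟨a, u⟩ => ?_⟩
    · have h1 : A v = 0 := congrArg Prod.fst hv
      have h2 : π v = 0 := congrArg Prod.snd hv
      have h3 : K.orthogonalProjectionOnto v = 0 := by simpa [π] using h2
      have h5 := Submodule.orthogonalProjectionOnto_mem_subspace_eq_self (K := K) ⟨v, h1⟩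
      rw [h3] at h5
      exact (congrArg Subtype.val h5).symm
    · obtain ⟨b, hb⟩ := hsurj a
      refine ⟨b + L (u - π b), Prod.ext ?_ ?_⟩
      · simp [hb]
      · simp [hπL]
  set G' : E ≃L[ℝ] F × EuclideanSpace ℝ (Fin d) :=
    (LinearEquiv.ofBijective (A.prod π).toLinearMap hbij).toContinuousLinearEquiv
  have hGd' : HasFDerivAt G (G' : E →L[ℝ] F × EuclideanSpace ℝ (Fin d)) x := by
    convert! hGd using 1
  set e := hG.contDiffAt.toOpenPartialHomeomorph G hGd' (by simp) with he
  have hecoe : ∀ y, e y = G y := fun y => by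
    rw [he, ContDiffAt.toOpenPartialHomeomorph_coe]
  have hxe : x ∈ e.source := ContDiffAt.mem_toOpenPartialHomeomorph_source _ hGd' (by simp)
  -- Smoothness of the inverse is needed on a whole neighbourhood, so the chart is cut down to the
  -- open set where `DG` is invertible.
  set R : Set E := {y | fderiv ℝ G y ∈ Set.range
    ((↑) : (E ≃L[ℝ] F × EuclideanSpace ℝ (Fin d)) → E →L[ℝ] F × EuclideanSpace ℝ (Fin d))}
  have hR : IsOpen R :=
    (ContinuousLinearEquiv.isOpen (𝕜 := ℝ)).preimage (hG.continuous_fderiv (by simp))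
  have hxR : x ∈ R := ⟨G', hGd'.fderiv.symm⟩
  set ι : EuclideanSpace ℝ (Fin d) → F × EuclideanSpace ℝ (Fin d) := fun u => (0, u)
  have hι : ContDiff ℝ ∞ ι := contDiff_const.prodMk contDiff_id
  set T : Set (F × EuclideanSpace ℝ (Fin d)) := e.target ∩ e.symm ⁻¹' R
  have hT : IsOpen T := e.isOpen_inter_preimage_symm hR
  set ψ : EuclideanSpace ℝ (Fin d) → E := fun u => e.symm (ι u)
  have hGψ : ∀ u ∈ ι ⁻¹' T, G (ψ u) = ι u := fun u hu => by
    rw [← hecoe]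
    exact e.right_inv hu.1
  have hψsmooth : ∀ u ∈ ι ⁻¹' T, ContDiffAt ℝ ∞ ψ u := fun u hu => by
    obtain ⟨B, hB⟩ := hu.2
    have h1 : ContDiffAt ℝ ∞ e.symm (ι u) := by
      refine e.contDiffAt_symm (f₀' := B) hu.1 ?_ ?_
      · rw [hB, he, ContDiffAt.toOpenPartialHomeomorph_coe]
        exact (hG.differentiable (by simp)).differentiableAt.hasFDerivAt
      · rw [he, ContDiffAt.toOpenPartialHomeomorph_coe]
        exact hG.contDiffAt
    exact h1.comp u hι.contDiffAt
  have hVo : IsOpen (ι ⁻¹' T) := hT.preimage hι.continuous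
  have hGx : ι (π x) = e x := by rw [hecoe]; simp [ι, hGdef, hx]
  refine ⟨d, ι ⁻¹' T, ψ, π x, ⟨hVo, fun u hu => (hψsmooth u hu).contDiffWithinAt, ?_, ?_, ?_⟩,
    ?_, ?_⟩
  · intro u hu u' hu' huu
    have := hGψ u hu
    rw [huu, hGψ u' hu'] at this
    exact (congrArg Prod.snd this).symm
  · intro u hu
    have h1 : HasFDerivAt (fun u' => π (ψ u')) (π.comp (fderiv ℝ ψ u)) u :=
      π.hasFDerivAt.comp u ((hψsmooth u hu).differentiableAt (by simp)).hasFDerivAt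
    have h2 : (fun u' => π (ψ u')) =ᶠ[𝓝 u] id := by
      filter_upwards [hVo.mem_nhds hu] with u' hu'
      exact congrArg Prod.snd (hGψ u' hu')
    have h3 : π.comp (fderiv ℝ ψ u) = ContinuousLinearMap.id ℝ _ :=
      (h1.congr_of_eventuallyEq h2.symm).unique (hasFDerivAt_id u)
    refine Function.LeftInverse.injective (g := π) fun w => ?_
    exact DFunLike.congr_fun h3 w
  · intro O hOV hO
    refine ⟨e.source ∩ π ⁻¹' O, e.open_source.inter (hO.preimage π.continuous), ?_⟩
    ext y
    constructor
    · rintro ⟨u, hu, rfl⟩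
      have h1 := hGψ u (hOV hu)
      have h2 : π (ψ u) = u := congrArg Prod.snd h1
      exact ⟨congrArg Prod.fst h1, e.map_target (hOV hu).1, by rw [Set.mem_preimage, h2]; exact hu⟩
    · rintro ⟨hy, hye, hyO⟩
      refine ⟨π y, hyO, ?_⟩
      have : ι (π y) = e y := by rw [hecoe]; exact Prod.ext (Eq.symm hy) rfl
      simp only [ψ]
      rw [this, e.left_inv hye]
  · change ι (π x) ∈ T
    rw [hGx]
    exact ⟨e.map_source hxe, by rw [Set.mem_preimage, e.left_inv hxe]; exact hxR⟩
  · simp only [ψ]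
    rw [hGx, e.left_inv hxe]

end LevelSets

theorem hasDerivAt_quadratic_polynomial (a b c : ℝ) :
    HasDerivAt (fun t : ℝ => a + t * b + t ^ 2 * c) b 0 := by
  have h := (((hasDerivAt_id' (0 : ℝ)).mul_const b).const_add a).fun_add
    ((hasDerivAt_pow 2 (0 : ℝ)).mul_const c)
  simpa using h

namespace SCCA

/-! ### The Frobenius inner product and its derivatives along lines. -/

section Frobenius

variable {m l : Type*} [Fintype m] [Fintype l]

theorem frobInner_comm (A B : Matrix m l ℝ) : frobInner A B = frobInner B A := by
  simp [frobInner, mul_comm]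

theorem frobInner_add_left (A B C : Matrix m l ℝ) :
    frobInner (A + B) C = frobInner A C + frobInner B C := by
  simp [frobInner, add_mul, Finset.sum_add_distrib]

theorem frobInner_smul_left (s : ℝ) (A B : Matrix m l ℝ) :
    frobInner (s • A) B = s * frobInner A B := by
  simp [frobInner, mul_assoc, Finset.mul_sum]

theorem frobInner_add_right (A B C : Matrix m l ℝ) :
    frobInner A (B + C) = frobInner A B + frobInner A C := by
  rw [frobInner_comm, frobInner_add_left, frobInner_comm B, frobInner_comm C]

theorem frobInner_smul_right (s : ℝ) (A B : Matrix m l ℝ) :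
    frobInner A (s • B) = s * frobInner A B := by
  rw [frobInner_comm, frobInner_smul_left, frobInner_comm]

theorem frobInner_sub_left (A B C : Matrix m l ℝ) :
    frobInner (A - B) C = frobInner A C - frobInner B C := by
  simp [frobInner, sub_mul, Finset.sum_sub_distrib]

theorem frobInner_neg_right (A B : Matrix m l ℝ) : frobInner A (-B) = -frobInner A B := by
  simp [frobInner]

theorem frobInner_zero_right (A : Matrix m l ℝ) : frobInner A 0 = 0 := by
  simp [frobInner]

theorem frobInner_single [DecidableEq m] [DecidableEq l] (A : Matrix m l ℝ) (i : m) (j : l) :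
    frobInner A (Matrix.single i j 1) = A i j := by
  unfold frobInner
  rw [Finset.sum_eq_single i, Finset.sum_eq_single j]
  · simp
  · intro b _ hb
    simp [Matrix.single, hb.symm]
  · simp
  · intro b _ hb
    simp [Matrix.single, hb.symm]
  · simp

theorem tendsto_frobInner {α : Type*} {f : Filter α} {A B : α → Matrix m l ℝ}
    {A₀ B₀ : Matrix m l ℝ} (hA : ∀ i j, Tendsto (fun k => A k i j) f (𝓝 (A₀ i j)))
    (hB : ∀ i j, Tendsto (fun k => B k i j) f (𝓝 (B₀ i j))) :
    Tendsto (fun k => frobInner (A k) (B k)) f (𝓝 (frobInner A₀ B₀)) :=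
  tendsto_finsetSum _ fun i _ => tendsto_finsetSum _ fun j _ => (hA i j).mul (hB i j)

theorem abs_le_maxNorm (A : Matrix m l ℝ) (i : m) (j : l) : |A i j| ≤ maxNorm A :=
  norm_le_pi_norm (fun ij : m × l => A ij.1 ij.2) (i, j)

theorem hasDerivAt_frobInner_line (L A B : Matrix m l ℝ) :
    HasDerivAt (fun t : ℝ => frobInner L (A + t • B)) (frobInner L B) 0 := by
  simp only [frobInner_add_right, frobInner_smul_right]
  simpa using ((hasDerivAt_id (0 : ℝ)).mul_const (frobInner L B)).const_add (frobInner L A)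

theorem hasDerivAt_frobSq_line (A B : Matrix m l ℝ) :
    HasDerivAt (fun t : ℝ => frobSq (A + t • B)) (2 * frobInner A B) 0 := by
  have h : (fun t : ℝ => frobSq (A + t • B)) =
      fun t => frobInner A A + t * (2 * frobInner A B) + t ^ 2 * frobInner B B := by
    funext t
    simp only [frobSq, frobInner_add_right, frobInner_smul_right, frobInner_add_left,
      frobInner_smul_left, frobInner_comm B A]
    ring
  rw [h]
  exact hasDerivAt_quadratic_polynomial _ _ _

end Frobenius

/-! ### The quadratic equations of the Stiefel manifold. -/

section Quadratic

variable {p r : ℕ}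

theorem hasDerivAt_quadratic_line (A : Matrix (Fin p) (Fin p) ℝ) (U H : Matrix (Fin p) (Fin r) ℝ)
    (i j : Fin r) :
    HasDerivAt (fun t : ℝ => ((U + t • H).transpose * A * (U + t • H)) i j)
      ((H.transpose * A * U + U.transpose * A * H) i j) 0 := by
  have h : (fun t : ℝ => ((U + t • H).transpose * A * (U + t • H)) i j) =
      fun t => (U.transpose * A * U) i j + t * (H.transpose * A * U + U.transpose * A * H) i j
        + t ^ 2 * (H.transpose * A * H) i j := by
    funext t
    simp only [Matrix.transpose_add, Matrix.transpose_smul, Matrix.add_mul, Matrix.mul_add,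
      Matrix.smul_mul, Matrix.mul_smul, Matrix.add_apply, Matrix.smul_apply, smul_eq_mul]
    ring
  rw [h]
  exact hasDerivAt_quadratic_polynomial _ _ _

/-- The differential of `U ↦ Uᵀ A U` at a point of the Stiefel manifold is onto the symmetric
matrices. -/
theorem exists_quadratic_deriv_eq {A : Matrix (Fin p) (Fin p) ℝ} {U : Matrix (Fin p) (Fin r) ℝ}
    (hU : U.transpose * A * U = 1)
    (c : {ij : Fin r × Fin r // ij.1 ≤ ij.2} → ℝ) :
    ∃ H : Matrix (Fin p) (Fin r) ℝ, ∀ ij : {ij : Fin r × Fin r // ij.1 ≤ ij.2},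
      (H.transpose * A * U + U.transpose * A * H) ij.1.1 ij.1.2 = c ij := by
  set C : Matrix (Fin r) (Fin r) ℝ := Matrix.of fun i j =>
    if h : i ≤ j then c ⟨(i, j), h⟩ else c ⟨(j, i), (not_le.1 h).le⟩ with hC
  have hsymm : C.transpose = C := by
    ext i j
    simp only [hC, Matrix.transpose_apply, Matrix.of_apply]
    rcases lt_trichotomy i j with h | h | h
    · simp [h.le, not_le.2 h]
    · subst h; rfl
    · simp [h.le, not_le.2 h]
  -- Since `Uᵀ A U = 1` and `C` is symmetric, each of the two terms of the derivative equals `C /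
  -- 2`.
  refine ⟨U * ((1 / 2 : ℝ) • C), fun ij => ?_⟩
  have h1 : (U * ((1 / 2 : ℝ) • C)).transpose * A * U = (1 / 2 : ℝ) • C := by
    rw [Matrix.transpose_mul, Matrix.transpose_smul, hsymm, Matrix.mul_assoc, Matrix.mul_assoc,
      ← Matrix.mul_assoc U.transpose, hU, Matrix.mul_one]
  have h2 : U.transpose * A * (U * ((1 / 2 : ℝ) • C)) = (1 / 2 : ℝ) • C := by
    rw [← Matrix.mul_assoc, hU, Matrix.one_mul]
  rw [h1, h2, ← add_smul]
  norm_num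
  simp [hC, ij.2]

end Quadratic

/-! ### The four blocks, the splitting of the Lagrangian, and the geometry of `𝒩`. -/

variable {n p q r : ℕ}

@[simp] theorem compU_apply (W : Var n p q r) (i j) : compU W i j = W (Sum.inl (i, j)) := rfl

@[simp] theorem compV_apply (W : Var n p q r) (i j) :
    compV W i j = W (Sum.inr (Sum.inl (i, j))) := rfl

@[simp] theorem compP_apply (W : Var n p q r) (i j) :
    compP W i j = W (Sum.inr (Sum.inr (Sum.inl (i, j)))) := rfl

@[simp] theorem compQ_apply (W : Var n p q r) (i j) :
    compQ W i j = W (Sum.inr (Sum.inr (Sum.inr (i, j)))) := rfl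

theorem compU_add_smul (W v : Var n p q r) (t : ℝ) :
    compU (W + t • v) = compU W + t • compU v := rfl

theorem compV_add_smul (W v : Var n p q r) (t : ℝ) :
    compV (W + t • v) = compV W + t • compV v := rfl

/-- The variable with the given four blocks. -/
def mkVar (U : Matrix (Fin p) (Fin r) ℝ) (V : Matrix (Fin q) (Fin r) ℝ)
    (P : Matrix (Fin n) (Fin r × Fin p) ℝ) (Q : Matrix (Fin n) (Fin r × Fin q) ℝ) : Var n p q r :=
  WithLp.toLp 2 (Sum.elim (fun ij => U ij.1 ij.2) (Sum.elim (fun ij => V ij.1 ij.2)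
    (Sum.elim (fun ij => P ij.1 ij.2) (fun ij => Q ij.1 ij.2))))

@[simp] theorem compU_mkVar (U : Matrix (Fin p) (Fin r) ℝ) (V : Matrix (Fin q) (Fin r) ℝ)
    (P : Matrix (Fin n) (Fin r × Fin p) ℝ) (Q : Matrix (Fin n) (Fin r × Fin q) ℝ) :
    compU (mkVar U V P Q) = U := rfl

@[simp] theorem compV_mkVar (U : Matrix (Fin p) (Fin r) ℝ) (V : Matrix (Fin q) (Fin r) ℝ)
    (P : Matrix (Fin n) (Fin r × Fin p) ℝ) (Q : Matrix (Fin n) (Fin r × Fin q) ℝ) :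
    compV (mkVar U V P Q) = V := rfl

@[simp] theorem compP_mkVar (U : Matrix (Fin p) (Fin r) ℝ) (V : Matrix (Fin q) (Fin r) ℝ)
    (P : Matrix (Fin n) (Fin r × Fin p) ℝ) (Q : Matrix (Fin n) (Fin r × Fin q) ℝ) :
    compP (mkVar U V P Q) = P := rfl

@[simp] theorem compQ_mkVar (U : Matrix (Fin p) (Fin r) ℝ) (V : Matrix (Fin q) (Fin r) ℝ)
    (P : Matrix (Fin n) (Fin r × Fin p) ℝ) (Q : Matrix (Fin n) (Fin r × Fin q) ℝ) :
    compQ (mkVar U V P Q) = Q := rfl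

/-! The constraints are linear. -/

theorem opA_apply (X : Matrix (Fin n) (Fin p) ℝ) (U : Matrix (Fin p) (Fin r) ℝ) (a ij) :
    opA X U a ij = X a ij.2 * U ij.2 ij.1 := by
  simp [opA, Matrix.mul_diagonal]

/-- `h₁` as a linear map. -/
def h₁Lin (X : Matrix (Fin n) (Fin p) ℝ) :
    Var n p q r →ₗ[ℝ] Matrix (Fin n) (Fin r × Fin p) ℝ where
  toFun := h₁ X
  map_add' W W' := by
    ext a ij
    simp [h₁, opA_apply]
    ring
  map_smul' s W := by
    ext a ij
    simp [h₁, opA_apply]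
    ring

/-- `h₂` as a linear map. -/
def h₂Lin (Y : Matrix (Fin n) (Fin q) ℝ) :
    Var n p q r →ₗ[ℝ] Matrix (Fin n) (Fin r × Fin q) ℝ where
  toFun := h₂ Y
  map_add' W W' := by
    ext a ij
    simp [h₂, opA_apply]
    ring
  map_smul' s W := by
    ext a ij
    simp [h₂, opA_apply]
    ring

theorem h₁_add_smul (X : Matrix (Fin n) (Fin p) ℝ) (W v : Var n p q r) (t : ℝ) :
    h₁ X (W + t • v) = h₁ X W + t • h₁ X v :=
  ((h₁Lin X).map_add W (t • v)).trans (congrArg _ ((h₁Lin X).map_smul t v))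

theorem h₂_add_smul (Y : Matrix (Fin n) (Fin q) ℝ) (W v : Var n p q r) (t : ℝ) :
    h₂ Y (W + t • v) = h₂ Y W + t • h₂ Y v :=
  ((h₂Lin Y).map_add W (t • v)).trans (congrArg _ ((h₂Lin Y).map_smul t v))

theorem contDiff_h₁ (X : Matrix (Fin n) (Fin p) ℝ) (a ij) :
    ContDiff ℝ ∞ fun W : Var n p q r => h₁ X W a ij :=
  (LinearMap.toContinuousLinearMap ((Matrix.entryLinearMap ℝ ℝ a ij).comp (h₁Lin X))).contDiff

theorem contDiff_h₂ (Y : Matrix (Fin n) (Fin q) ℝ) (a ij) :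
    ContDiff ℝ ∞ fun W : Var n p q r => h₂ Y W a ij :=
  (LinearMap.toContinuousLinearMap ((Matrix.entryLinearMap ℝ ℝ a ij).comp (h₂Lin Y))).contDiff

theorem contDiff_frobInner {m l : Type*} [Fintype m] [Fintype l]
    {A B : Var n p q r → Matrix m l ℝ} (hA : ∀ i j, ContDiff ℝ ∞ fun W => A W i j)
    (hB : ∀ i j, ContDiff ℝ ∞ fun W => B W i j) :
    ContDiff ℝ ∞ fun W => frobInner (A W) (B W) :=
  ContDiff.sum fun i _ => ContDiff.sum fun j _ => (hA i j).mul (hB i j)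

/-! The smooth and the nonsmooth part of the objective. -/

/-- `½ ‖X U - Y V‖_F²`. -/
def smoothPart (X : Matrix (Fin n) (Fin p) ℝ) (Y : Matrix (Fin n) (Fin q) ℝ) (W : Var n p q r) :
    ℝ :=
  1 / 2 * frobSq (X * compU W - Y * compV W)

theorem contDiff_smoothPart (X : Matrix (Fin n) (Fin p) ℝ) (Y : Matrix (Fin n) (Fin q) ℝ) :
    ContDiff ℝ ∞ (smoothPart (r := r) X Y) := by
  have h : ∀ i j, ContDiff ℝ ∞ fun W : Var n p q r => (X * compU W - Y * compV W) i j := by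
    intro i j
    simp only [Matrix.sub_apply, Matrix.mul_apply, compU_apply, compV_apply]
    fun_prop
  exact contDiff_const.mul (contDiff_frobInner h h)

/-- `λ_u ‖P‖_* + λ_v ‖Q‖_*` as a seminorm. -/
def nuclearPart (n p q r : ℕ) (lu lv : NNReal) : Seminorm ℝ (Var n p q r) :=
  lu • (nuclearSeminorm _ _).comp
      ({ toFun := compP, map_add' := fun _ _ => rfl, map_smul' := fun _ _ => rfl } :
        Var n p q r →ₗ[ℝ] Matrix (Fin n) (Fin r × Fin p) ℝ) +
    lv • (nuclearSeminorm _ _).comp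
      ({ toFun := compQ, map_add' := fun _ _ => rfl, map_smul' := fun _ _ => rfl } :
        Var n p q r →ₗ[ℝ] Matrix (Fin n) (Fin r × Fin q) ℝ)

theorem continuous_nuclearPart (lu lv : NNReal) : Continuous (nuclearPart n p q r lu lv) :=
  continuousOn_univ.1 ((nuclearPart n p q r lu lv).convexOn.continuousOn isOpen_univ)

theorem objF_eq (X : Matrix (Fin n) (Fin p) ℝ) (Y : Matrix (Fin n) (Fin q) ℝ) (lu lv : NNReal) :
    objF (r := r) X Y lu lv = fun W => smoothPart X Y W + nuclearPart n p q r lu lv W := by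
  funext W
  exact add_assoc _ _ _

/-- The smooth part of the augmented Lagrangian. -/
def smoothLagrangian (X : Matrix (Fin n) (Fin p) ℝ) (Y : Matrix (Fin n) (Fin q) ℝ)
    (rho : ℝ) (L₁ : Matrix (Fin n) (Fin r × Fin p) ℝ) (L₂ : Matrix (Fin n) (Fin r × Fin q) ℝ)
    (W : Var n p q r) : ℝ :=
  smoothPart X Y W - frobInner L₁ (h₁ X W) - frobInner L₂ (h₂ Y W)
    + rho / 2 * frobSq (h₁ X W) + rho / 2 * frobSq (h₂ Y W)

theorem augLagrangian_eq (X : Matrix (Fin n) (Fin p) ℝ) (Y : Matrix (Fin n) (Fin q) ℝ)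
    (lu lv : NNReal) (rho : ℝ) (L₁ : Matrix (Fin n) (Fin r × Fin p) ℝ)
    (L₂ : Matrix (Fin n) (Fin r × Fin q) ℝ) :
    augLagrangian X Y lu lv rho L₁ L₂ = fun W =>
      smoothLagrangian X Y rho L₁ L₂ W + nuclearPart n p q r lu lv W := by
  funext W
  simp only [augLagrangian, objF_eq, smoothLagrangian]
  ring

theorem contDiff_smoothLagrangian (X : Matrix (Fin n) (Fin p) ℝ) (Y : Matrix (Fin n) (Fin q) ℝ)
    (rho : ℝ) (L₁ : Matrix (Fin n) (Fin r × Fin p) ℝ) (L₂ : Matrix (Fin n) (Fin r × Fin q) ℝ) :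
    ContDiff ℝ ∞ (smoothLagrangian X Y rho L₁ L₂) := by
  have h1 := contDiff_h₁ (q := q) (r := r) X
  have h2 := contDiff_h₂ (p := p) (r := r) Y
  have e1 : ContDiff ℝ ∞ fun W : Var n p q r => frobInner L₁ (h₁ X W) :=
    contDiff_frobInner (fun _ _ => contDiff_const) h1
  have e2 : ContDiff ℝ ∞ fun W : Var n p q r => frobInner L₂ (h₂ Y W) :=
    contDiff_frobInner (fun _ _ => contDiff_const) h2
  have e3 : ContDiff ℝ ∞ fun W : Var n p q r => frobSq (h₁ X W) := contDiff_frobInner h1 h1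
  have e4 : ContDiff ℝ ∞ fun W : Var n p q r => frobSq (h₂ Y W) := contDiff_frobInner h2 h2
  have e0 := contDiff_smoothPart (r := r) X Y
  unfold smoothLagrangian
  fun_prop

theorem hasDerivAt_line {E F : Type*} [NormedAddCommGroup E] [NormedSpace ℝ E]
    [NormedAddCommGroup F] [NormedSpace ℝ F] {f : E → F} (hf : ContDiff ℝ ∞ f) (x v : E) :
    HasDerivAt (fun t : ℝ => f (x + t • v)) (fderiv ℝ f x v) 0 := by
  have hd : HasDerivAt (fun t : ℝ => x + t • v) v 0 := by
    simpa using ((hasDerivAt_id (0 : ℝ)).smul_const v).const_add x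
  have h := ((hf.differentiable (by simp)) (x + (0 : ℝ) • v)).hasFDerivAt.comp_hasDerivAt (0 : ℝ) hd
  simpa [Function.comp_def] using h

/-- The gradient of the smooth part of the augmented Lagrangian is the gradient of the Lagrangian at
the updated multipliers. -/
theorem fderiv_smoothLagrangian (X : Matrix (Fin n) (Fin p) ℝ) (Y : Matrix (Fin n) (Fin q) ℝ)
    (rho : ℝ) (L₁ : Matrix (Fin n) (Fin r × Fin p) ℝ) (L₂ : Matrix (Fin n) (Fin r × Fin q) ℝ)
    (W v : Var n p q r) :
    fderiv ℝ (smoothLagrangian X Y rho L₁ L₂) W v = fderiv ℝ (smoothPart X Y) W v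
      - frobInner (L₁ - rho • h₁ X W) (h₁ X v) - frobInner (L₂ - rho • h₂ Y W) (h₂ Y v) := by
  refine (hasDerivAt_line (contDiff_smoothLagrangian X Y rho L₁ L₂) W v).unique ?_
  simp only [smoothLagrangian, h₁_add_smul, h₂_add_smul]
  have h := ((((hasDerivAt_line (contDiff_smoothPart (r := r) X Y) W v).sub
    (hasDerivAt_frobInner_line L₁ (h₁ X W) (h₁ X v))).sub
    (hasDerivAt_frobInner_line L₂ (h₂ Y W) (h₂ Y v))).add
    ((hasDerivAt_frobSq_line (h₁ X W) (h₁ X v)).const_mul (rho / 2))).add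
    ((hasDerivAt_frobSq_line (h₂ Y W) (h₂ Y v)).const_mul (rho / 2))
  convert! h using 1
  simp only [frobInner_sub_left, frobInner_smul_left]
  ring

theorem fderiv_smoothPart_eq_zero (X : Matrix (Fin n) (Fin p) ℝ) (Y : Matrix (Fin n) (Fin q) ℝ)
    (W : Var n p q r) {v : Var n p q r} (hU : compU v = 0) (hV : compV v = 0) :
    fderiv ℝ (smoothPart X Y) W v = 0 := by
  refine (hasDerivAt_line (contDiff_smoothPart (r := r) X Y) W v).unique ?_
  simp only [smoothPart, compU_add_smul, compV_add_smul, hU, hV, smul_zero, add_zero]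
  exact hasDerivAt_const _ _

/-! The manifold `𝒩`. -/

/-- The entries on and above the diagonal of the equations that define `𝒩`. -/
def stiefelEqs (X : Matrix (Fin n) (Fin p) ℝ) (Y : Matrix (Fin n) (Fin q) ℝ) (W : Var n p q r) :
    ({ij : Fin r × Fin r // ij.1 ≤ ij.2} → ℝ) × ({ij : Fin r × Fin r // ij.1 ≤ ij.2} → ℝ) :=
  (fun ij => ((compU W).transpose * (X.transpose * X) * compU W) ij.1.1 ij.1.2
      - (1 : Matrix (Fin r) (Fin r) ℝ) ij.1.1 ij.1.2,
    fun ij => ((compV W).transpose * (Y.transpose * Y) * compV W) ij.1.1 ij.1.2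
      - (1 : Matrix (Fin r) (Fin r) ℝ) ij.1.1 ij.1.2)

theorem contDiff_stiefelEqs (X : Matrix (Fin n) (Fin p) ℝ) (Y : Matrix (Fin n) (Fin q) ℝ) :
    ContDiff ℝ ∞ (stiefelEqs (r := r) X Y) := by
  refine ContDiff.prodMk (contDiff_pi.2 fun ij => ?_) (contDiff_pi.2 fun ij => ?_) <;>
    simp only [Matrix.mul_apply (M := _ * _), Matrix.mul_apply (M := Matrix.transpose (compU _)),
      Matrix.mul_apply (M := Matrix.transpose (compV _)), Matrix.transpose_apply, compU_apply,
      compV_apply] <;>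
    fun_prop

theorem quadratic_eq_one_iff (X : Matrix (Fin n) (Fin p) ℝ) (U : Matrix (Fin p) (Fin r) ℝ) :
    U ∈ stiefel r X ↔ ∀ ij : {ij : Fin r × Fin r // ij.1 ≤ ij.2},
      (U.transpose * (X.transpose * X) * U) ij.1.1 ij.1.2
        - (1 : Matrix (Fin r) (Fin r) ℝ) ij.1.1 ij.1.2 = 0 := by
  constructor
  · intro h ij
    rw [show U.transpose * (X.transpose * X) * U = 1 from h, sub_self]
  · intro h
    have hsymm : (U.transpose * (X.transpose * X) * U).transpose
        = U.transpose * (X.transpose * X) * U := by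
      simp [Matrix.transpose_mul, Matrix.mul_assoc]
    change _ = _
    ext i j
    rcases le_total i j with hij | hij
    · exact sub_eq_zero.1 (h ⟨(i, j), hij⟩)
    · rw [← hsymm, ← Matrix.transpose_one]
      exact sub_eq_zero.1 (h ⟨(j, i), hij⟩)

theorem manifoldN_eq (X : Matrix (Fin n) (Fin p) ℝ) (Y : Matrix (Fin n) (Fin q) ℝ) :
    manifoldN r X Y = {W | stiefelEqs X Y W = 0} := by
  ext W
  simp only [manifoldN, Set.mem_ofPred_eq, quadratic_eq_one_iff, stiefelEqs, Prod.ext_iff,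
    funext_iff]
  rfl

theorem isClosed_manifoldN (X : Matrix (Fin n) (Fin p) ℝ) (Y : Matrix (Fin n) (Fin q) ℝ) :
    IsClosed (manifoldN r X Y) := by
  rw [manifoldN_eq]
  exact isClosed_eq (contDiff_stiefelEqs X Y).continuous continuous_const

/-- The derivative of `Uᵀ A U` takes symmetric values, so surjectivity relies on keeping only the
entries with `i ≤ j`. -/
theorem surjective_fderiv_stiefelEqs {X : Matrix (Fin n) (Fin p) ℝ} {Y : Matrix (Fin n) (Fin q) ℝ}
    {W : Var n p q r} (hW : W ∈ manifoldN r X Y) :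
    Function.Surjective (fderiv ℝ (stiefelEqs (r := r) X Y) W) := by
  rintro ⟨a, b⟩
  obtain ⟨H, hH⟩ := exists_quadratic_deriv_eq hW.1 a
  obtain ⟨K, hK⟩ := exists_quadratic_deriv_eq hW.2 b
  refine ⟨mkVar H K 0 0, ?_⟩
  refine (hasDerivAt_line (contDiff_stiefelEqs X Y) W _).unique ?_
  refine HasDerivAt.prodMk (hasDerivAt_pi.2 fun ij => ?_) (hasDerivAt_pi.2 fun ij => ?_) <;>
    simp only [compU_add_smul, compV_add_smul, compU_mkVar, compV_mkVar]
  · exact hH ij ▸ (hasDerivAt_quadratic_line _ _ _ _ _).sub_const _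
  · exact hK ij ▸ (hasDerivAt_quadratic_line _ _ _ _ _).sub_const _

theorem exists_isInverseChart_manifoldN {X : Matrix (Fin n) (Fin p) ℝ}
    {Y : Matrix (Fin n) (Fin q) ℝ} {W : Var n p q r} (hW : W ∈ manifoldN r X Y) :
    ∃ (d : ℕ) (V : Set (EuclideanSpace ℝ (Fin d))) (ψ : EuclideanSpace ℝ (Fin d) → Var n p q r)
      (u₀ : EuclideanSpace ℝ (Fin d)),
      IsInverseChart (manifoldN r X Y) V ψ ∧ u₀ ∈ V ∧ ψ u₀ = W := by
  have h := manifoldN_eq (r := r) X Y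
  rw [h]
  exact exists_isInverseChart_levelSet (contDiff_stiefelEqs X Y) (h.subset hW)
    (surjective_fderiv_stiefelEqs hW)

/-- `𝒩` does not restrict `P` and `Q`, so the whole line through `W` in direction `v` stays in it.
-/
theorem mem_tangentSpaceAt_of_vertical {X : Matrix (Fin n) (Fin p) ℝ}
    {Y : Matrix (Fin n) (Fin q) ℝ} {W v : Var n p q r} (hW : W ∈ manifoldN r X Y)
    (hU : compU v = 0) (hV : compV v = 0) : v ∈ tangentSpaceAt (manifoldN r X Y) W := by
  refine Submodule.subset_span ⟨fun t => W + t • v, by fun_prop, by simp, ?_, ?_⟩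
  · refine Eventually.of_forall fun t => ?_
    simpa [manifoldN, compU_add_smul, compV_add_smul, hU, hV] using hW
  · simpa using ((hasDerivAt_id (0 : ℝ)).smul_const v).const_add W

/-- Points of the generalized Stiefel manifold have bounded entries. -/
theorem exists_bound_of_mem_stiefel {X : Matrix (Fin n) (Fin p) ℝ}
    (hX : (X.transpose * X).PosDef) (i : Fin p) (j : Fin r) :
    ∃ M, ∀ U ∈ stiefel r X, |U i j| ≤ M := by
  -- `U` is recovered as `(XᵀX)⁻¹ Xᵀ (X U)`, and `X U` has orthonormal columns, hence entries of
  -- absolute value at most `1`.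
  refine ⟨∑ a, |((X.transpose * X)⁻¹ * X.transpose) i a|, fun U hU => ?_⟩
  have hdet : IsUnit (X.transpose * X).det := hX.det_pos.ne'.isUnit
  have h1 : U = ((X.transpose * X)⁻¹ * X.transpose) * (X * U) := by
    rw [Matrix.mul_assoc, ← Matrix.mul_assoc X.transpose, ← Matrix.mul_assoc,
      Matrix.nonsing_inv_mul _ hdet, Matrix.one_mul]
  have h2 : (X * U).transpose * (X * U) = 1 := by
    rw [Matrix.transpose_mul]
    simpa [Matrix.mul_assoc] using (show U.transpose * (X.transpose * X) * U = 1 from hU)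
  have h3 : ∀ a, |(X * U) a j| ≤ 1 := fun a => by
    have h4 := congrFun (congrFun h2 j) j
    rw [Matrix.mul_apply, Matrix.one_apply_eq] at h4
    have h5 : (X * U) a j * (X * U) a j ≤ 1 := by
      rw [← h4]
      exact Finset.single_le_sum
        (f := fun a => (X * U).transpose j a * (X * U) a j)
        (fun b _ => mul_self_nonneg _) (Finset.mem_univ a)
    exact abs_le_one_iff_mul_self_le_one.2 h5
  conv_lhs => rw [h1, Matrix.mul_apply]
  refine (Finset.abs_sum_le_sum_abs _ _).trans (Finset.sum_le_sum fun a _ => ?_)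
  rw [abs_mul]
  exact mul_le_of_le_one_right (abs_nonneg _) (h3 a)

/-! Riemannian gradients of the constraints. -/

theorem riemGrad_mem {E : Type*} [NormedAddCommGroup E] [InnerProductSpace ℝ E]
    [FiniteDimensional ℝ E] (S : Set E) (f : E → ℝ) (x : E) :
    riemGrad S f x ∈ tangentSpaceAt S x :=
  Submodule.starProjection_apply_mem _ _

theorem inner_riemGrad_linear {E : Type*} [NormedAddCommGroup E] [InnerProductSpace ℝ E]
    [FiniteDimensional ℝ E] {S : Set E} (f : E →ₗ[ℝ] ℝ) {x v : E} (hv : v ∈ tangentSpaceAt S x) :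
    ⟪riemGrad S f x, v⟫ = f v := by
  have : CompleteSpace E := FiniteDimensional.complete ℝ E
  rw [riemGrad, Submodule.inner_starProjection_left_eq_right,
    Submodule.starProjection_eq_self_iff.2 hv, inner_gradient_left]
  exact DFunLike.congr_fun (LinearMap.toContinuousLinearMap f).fderiv v

theorem inner_gradH₁ {X : Matrix (Fin n) (Fin p) ℝ} {Y : Matrix (Fin n) (Fin q) ℝ}
    {W v : Var n p q r} (hv : v ∈ tangentSpaceAt (manifoldN r X Y) W) (ij) :
    ⟪gradH₁ X Y W ij, v⟫ = h₁ X v ij.1 ij.2 :=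
  inner_riemGrad_linear ((Matrix.entryLinearMap ℝ ℝ ij.1 ij.2).comp (h₁Lin X)) hv

theorem inner_gradH₂ {X : Matrix (Fin n) (Fin p) ℝ} {Y : Matrix (Fin n) (Fin q) ℝ}
    {W v : Var n p q r} (hv : v ∈ tangentSpaceAt (manifoldN r X Y) W) (ij) :
    ⟪gradH₂ X Y W ij, v⟫ = h₂ Y v ij.1 ij.2 :=
  inner_riemGrad_linear ((Matrix.entryLinearMap ℝ ℝ ij.1 ij.2).comp (h₂Lin Y)) hv

end SCCA

/-! ### Real sequences: compactness, contraction, and the penalty rule. -/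

theorem Ultrafilter.exists_tendsto_of_eventually_abs_le {α : Type*} (l : Ultrafilter α) {f : α → ℝ}
    {M : ℝ} (h : ∀ᶠ k in (l : Filter α), |f k| ≤ M) : ∃ a, Tendsto f l (𝓝 a) := by
  obtain ⟨a, -, ha⟩ := (isCompact_Icc (a := -M) (b := M)).ultrafilter_le_nhds (l.map f)
    (le_principal_iff.2 (h.mono fun k hk => abs_le.1 hk))
  exact ⟨a, ha⟩

theorem tendsto_zero_of_eventually_le_mul {a : ℕ → ℝ} {τ : ℝ} (hτ : τ < 1) (ha : ∀ k, 0 ≤ a k)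
    (h : ∀ᶠ k in atTop, a (k + 1) ≤ τ * a k) : Tendsto a atTop (𝓝 0) := by
  refine (summable_of_ratio_norm_eventually_le hτ ?_).tendsto_atTop_zero
  filter_upwards [h] with k hk
  rwa [Real.norm_of_nonneg (ha _), Real.norm_of_nonneg (ha _)]

/-- A penalty parameter that grows by a fixed factor at each step of insufficient decrease tends
to infinity, unless the decrease is eventually sufficient at each step. -/
theorem tendsto_atTop_or_eventually_of_penalty_rule {rho : ℕ → ℝ} {γ : ℝ} {D : ℕ → Prop}
    (hγ : 1 < γ) (h0 : 1 < rho 0) (hkeep : ∀ k, D k → rho (k + 1) = rho k)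
    (hgrow : ∀ k, ¬ D k → rho (k + 1) = γ * rho k) :
    Tendsto rho atTop atTop ∨ ∀ᶠ k in atTop, D k := by
  have h1 : ∀ k, 1 < rho k := fun k => by
    induction k with
    | zero => exact h0
    | succ k ih =>
      by_cases hD : D k
      · rwa [hkeep k hD]
      · rw [hgrow k hD]
        nlinarith
  have hmono : Monotone rho := monotone_nat_of_le_succ fun k => by
    by_cases hD : D k
    · exact (hkeep k hD).ge
    · rw [hgrow k hD]
      nlinarith [h1 k]
  refine (tendsto_atTop_of_monotone hmono).imp_right fun ⟨l, hl⟩ => ?_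
  have hl1 : 1 ≤ l := ge_of_tendsto' hl fun k => (h1 k).le
  -- If the penalties converge to `l ≥ 1`, this difference tends to a negative number, whereas it
  -- vanishes at every growth step.
  have hlim : Tendsto (fun k => rho (k + 1) - γ * rho k) atTop (𝓝 (l - γ * l)) :=
    ((tendsto_add_atTop_iff_nat 1).2 hl).sub (hl.const_mul γ)
  have hneg : l - γ * l < 0 := by nlinarith
  filter_upwards [hlim.eventually_lt_const hneg] with k hk
  by_contra hD
  rw [hgrow k hD, sub_self] at hk
  exact lt_irrefl _ hk

theorem tendsto_zero_of_mul_eq_sub {rho x y : ℕ → ℝ} {M : ℝ} (hrho : Tendsto rho atTop atTop)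
    (h : ∀ k, y (k + 1) = y k - rho k * x (k + 1)) (hy : ∀ᶠ k in atTop, |y k| ≤ M) :
    Tendsto x atTop (𝓝 0) := by
  rw [← tendsto_add_atTop_iff_nat 1]
  refine squeeze_zero_norm' ?_ ((hrho.inv_tendsto_atTop.const_mul (2 * M)).trans_eq (by simp))
  filter_upwards [hy, (tendsto_add_atTop_nat 1).eventually hy, hrho.eventually_gt_atTop 0]
    with k h1 h2 h3
  have h4 : x (k + 1) = (y k - y (k + 1)) * (rho k)⁻¹ := by
    rw [h k]
    field_simp
    ring
  rw [h4, Real.norm_eq_abs, abs_mul, abs_of_pos (inv_pos.2 h3)]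
  refine mul_le_mul_of_nonneg_right ?_ (inv_pos.2 h3).le
  exact (abs_sub _ _).trans (by linarith)

/-! ### Bounded multipliers, asymptotic feasibility, and limit points. -/

namespace SCCA

variable {n p q r : ℕ} {X : Matrix (Fin n) (Fin p) ℝ} {Y : Matrix (Fin n) (Fin q) ℝ}
  {lu lv : NNReal} {τ γ : ℝ} {ε : ℕ → ℝ} {W : ℕ → Var n p q r}
  {L₁ : ℕ → Matrix (Fin n) (Fin r × Fin p) ℝ} {L₂ : ℕ → Matrix (Fin n) (Fin r × Fin q) ℝ}
  {rho : ℕ → ℝ}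

/-- Approximate stationarity of the Lagrangian at the updated multipliers. -/
theorem IsGenerated.le_lagrangian (h : IsGenerated X Y lu lv τ γ ε W L₁ L₂ rho) (k : ℕ)
    {v : Var n p q r} (hv : v ∈ tangentSpaceAt (manifoldN r X Y) (W (k + 1))) :
    -(ε k * ‖v‖) ≤ fderiv ℝ (smoothPart X Y) (W (k + 1)) v - frobInner (L₁ (k + 1)) (h₁ X v)
      - frobInner (L₂ (k + 1)) (h₂ Y v)
      + (nuclearPart n p q r lu lv (W (k + 1) + v) - nuclearPart n p q r lu lv (W (k + 1))) := by
  obtain ⟨δ, hδ, hδε⟩ := h.stopping k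
  rw [augLagrangian_eq] at hδ
  have h1 := inner_le_of_mem_riemSubdiff
    ((contDiff_smoothLagrangian X Y _ _ _).contDiffAt.hasStrictFDerivAt (by simp))
    (continuous_nuclearPart lu lv) hδ hv
  rw [fderiv_smoothLagrangian, ← h.dual₁, ← h.dual₂] at h1
  refine le_trans ?_ h1
  have h2 := abs_real_inner_le_norm δ v
  have h3 := mul_le_mul_of_nonneg_right hδε (norm_nonneg v)
  exact (neg_le_neg (h2.trans h3)).trans (neg_abs_le _)

theorem IsGenerated.abs_multiplier_le (h : IsGenerated X Y lu lv τ γ ε W L₁ L₂ rho) (k : ℕ)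
    {v : Var n p q r} (hU : compU v = 0) (hV : compV v = 0) :
    |frobInner (L₁ (k + 1)) (h₁ X v) + frobInner (L₂ (k + 1)) (h₂ Y v)| ≤
      nuclearPart n p q r lu lv v + ε k * ‖v‖ := by
  have key : ∀ v : Var n p q r, compU v = 0 → compV v = 0 →
      frobInner (L₁ (k + 1)) (h₁ X v) + frobInner (L₂ (k + 1)) (h₂ Y v) ≤
        nuclearPart n p q r lu lv v + ε k * ‖v‖ := by
    intro v hU hV
    have h1 := h.le_lagrangian k (mem_tangentSpaceAt_of_vertical (h.mem (k + 1)) hU hV)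
    rw [fderiv_smoothPart_eq_zero X Y _ hU hV] at h1
    have h2 := map_add_le_add (nuclearPart n p q r lu lv) (W (k + 1)) v
    linarith
  have h1 := key v hU hV
  -- The reverse direction is also vertical and the right side is even, which gives the two-sided
  -- bound.
  have h2 := key (-v) (by ext; simpa using congrFun₂ hU _ _) (by ext; simpa using congrFun₂ hV _ _)
  have e1 : h₁ X (-v) = -h₁ X v := (h₁Lin X).map_neg v
  have e2 : h₂ Y (-v) = -h₂ Y v := (h₂Lin Y).map_neg v
  rw [e1, e2, frobInner_neg_right, frobInner_neg_right, map_neg_eq_map, norm_neg] at h2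
  exact abs_le.2 ⟨by linarith, h1⟩

theorem IsGenerated.eventually_abs_multiplier_le (h : IsGenerated X Y lu lv τ γ ε W L₁ L₂ rho)
    (hε : Tendsto ε atTop (𝓝 0)) {v : Var n p q r} (hU : compU v = 0) (hV : compV v = 0) :
    ∀ᶠ k in atTop, |frobInner (L₁ k) (h₁ X v) + frobInner (L₂ k) (h₂ Y v)| ≤
      nuclearPart n p q r lu lv v + ‖v‖ := by
  rw [← map_add_atTop_eq_nat 1, eventually_map]
  filter_upwards [hε.eventually_le_const one_pos] with k hk
  refine (h.abs_multiplier_le k hU hV).trans ?_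
  have := mul_le_mul_of_nonneg_right hk (norm_nonneg v)
  linarith

/-- Perturbing a single entry of `P` changes `h₁` by minus an elementary matrix and leaves `h₂`
alone, so the pairing isolates one entry of the multiplier. -/
theorem IsGenerated.exists_bound₁ (h : IsGenerated X Y lu lv τ γ ε W L₁ L₂ rho)
    (hε : Tendsto ε atTop (𝓝 0)) (i j) : ∃ M, ∀ᶠ k in atTop, |L₁ k i j| ≤ M := by
  have e1 : h₁ X (mkVar 0 0 (Matrix.single i j 1) 0 : Var n p q r) = -Matrix.single i j 1 := by
    ext a b
    simp [h₁, opA_apply, -compU_apply]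
  have e2 : h₂ Y (mkVar 0 0 (Matrix.single i j 1) 0 : Var n p q r) = 0 := by
    ext a b
    simp [h₂, opA_apply, -compV_apply]
  have hb := h.eventually_abs_multiplier_le hε
    (v := (mkVar 0 0 (Matrix.single i j 1) 0 : Var n p q r)) rfl rfl
  simp only [e1, e2, frobInner_neg_right, frobInner_single, frobInner_zero_right, add_zero,
    abs_neg] at hb
  exact ⟨_, hb⟩

theorem IsGenerated.exists_bound₂ (h : IsGenerated X Y lu lv τ γ ε W L₁ L₂ rho)
    (hε : Tendsto ε atTop (𝓝 0)) (i j) : ∃ M, ∀ᶠ k in atTop, |L₂ k i j| ≤ M := by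
  have e1 : h₁ X (mkVar 0 0 0 (Matrix.single i j 1) : Var n p q r) = 0 := by
    ext a b
    simp [h₁, opA_apply, -compU_apply]
  have e2 : h₂ Y (mkVar 0 0 0 (Matrix.single i j 1) : Var n p q r) = -Matrix.single i j 1 := by
    ext a b
    simp [h₂, opA_apply, -compV_apply]
  have hb := h.eventually_abs_multiplier_le hε
    (v := (mkVar 0 0 0 (Matrix.single i j 1) : Var n p q r)) rfl rfl
  simp only [e1, e2, frobInner_neg_right, frobInner_single, frobInner_zero_right, zero_add,
    abs_neg] at hb
  exact ⟨_, hb⟩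

/-- The iterates are asymptotically feasible. -/
theorem IsGenerated.tendsto_residual (h : IsGenerated X Y lu lv τ γ ε W L₁ L₂ rho)
    (hε : Tendsto ε atTop (𝓝 0)) (hτ : τ < 1) (hγ : 1 < γ) (hrho : 1 < rho 0) :
    (∀ i j, Tendsto (fun k => h₁ X (W k) i j) atTop (𝓝 0)) ∧
      ∀ i j, Tendsto (fun k => h₂ Y (W k) i j) atTop (𝓝 0) := by
  rcases tendsto_atTop_or_eventually_of_penalty_rule hγ hrho h.penalty_keep h.penalty_grow
    with hinf | hdec
  · refine ⟨fun i j => ?_, fun i j => ?_⟩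
    · obtain ⟨M, hM⟩ := h.exists_bound₁ hε i j
      exact tendsto_zero_of_mul_eq_sub hinf (fun k => by rw [h.dual₁]; rfl) hM
    · obtain ⟨M, hM⟩ := h.exists_bound₂ hε i j
      exact tendsto_zero_of_mul_eq_sub hinf (fun k => by rw [h.dual₂]; rfl) hM
  · refine ⟨fun i j => ?_, fun i j => ?_⟩
    · exact squeeze_zero_norm (fun k => abs_le_maxNorm _ i j)
        (tendsto_zero_of_eventually_le_mul hτ (fun k => norm_nonneg _) (hdec.mono fun k hk => hk.1))
    · exact squeeze_zero_norm (fun k => abs_le_maxNorm _ i j)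
        (tendsto_zero_of_eventually_le_mul hτ (fun k => norm_nonneg _) (hdec.mono fun k hk => hk.2))

theorem IsGenerated.exists_bound_coord (h : IsGenerated X Y lu lv τ γ ε W L₁ L₂ rho)
    (hX : (X.transpose * X).PosDef) (hY : (Y.transpose * Y).PosDef)
    (hε : Tendsto ε atTop (𝓝 0)) (hτ : τ < 1) (hγ : 1 < γ) (hrho : 1 < rho 0)
    (a : Idx n p q r) : ∃ M, ∀ᶠ k in atTop, |W k a| ≤ M := by
  obtain ⟨hr₁, hr₂⟩ := h.tendsto_residual hε hτ hγ hrho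
  rcases a with ⟨i, j⟩ | ⟨i, j⟩ | ⟨i, j, l⟩ | ⟨i, j, l⟩
  · obtain ⟨M, hM⟩ := exists_bound_of_mem_stiefel hX i j
    exact ⟨M, Eventually.of_forall fun k => hM _ (h.mem k).1⟩
  · obtain ⟨M, hM⟩ := exists_bound_of_mem_stiefel hY i j
    exact ⟨M, Eventually.of_forall fun k => hM _ (h.mem k).2⟩
  · obtain ⟨M, hM⟩ := exists_bound_of_mem_stiefel hX l j
    refine ⟨|X i l| * M + 1, ?_⟩
    filter_upwards [(hr₁ i (j, l)).abs.eventually_le_const (by simp : |(0 : ℝ)| < 1)] with k hk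
    -- `P = A_X(U) - h₁`: the first term is bounded on the Stiefel manifold and the residual is
    -- eventually at most `1`.
    have h1 : W k (Sum.inr (Sum.inr (Sum.inl (i, (j, l))))) =
        X i l * compU (W k) l j - h₁ X (W k) i (j, l) := by
      simp [h₁, opA_apply]
    rw [h1]
    refine (abs_sub _ _).trans (add_le_add ?_ hk)
    rw [abs_mul]
    exact mul_le_mul_of_nonneg_left (hM _ (h.mem k).1) (abs_nonneg _)
  · obtain ⟨M, hM⟩ := exists_bound_of_mem_stiefel hY l j
    refine ⟨|Y i l| * M + 1, ?_⟩
    filter_upwards [(hr₂ i (j, l)).abs.eventually_le_const (by simp : |(0 : ℝ)| < 1)] with k hk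
    have h1 : W k (Sum.inr (Sum.inr (Sum.inr (i, (j, l))))) =
        Y i l * compV (W k) l j - h₂ Y (W k) i (j, l) := by
      simp [h₂, opA_apply]
    rw [h1]
    refine (abs_sub _ _).trans (add_le_add ?_ hk)
    rw [abs_mul]
    exact mul_le_mul_of_nonneg_left (hM _ (h.mem k).2) (abs_nonneg _)

theorem IsGenerated.exists_mapClusterPt (h : IsGenerated X Y lu lv τ γ ε W L₁ L₂ rho)
    (hX : (X.transpose * X).PosDef) (hY : (Y.transpose * Y).PosDef)
    (hε : Tendsto ε atTop (𝓝 0)) (hτ : τ < 1) (hγ : 1 < γ) (hrho : 1 < rho 0) :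
    ∃ Wstar, MapClusterPt Wstar atTop W := by
  have hl : ((Ultrafilter.of atTop : Ultrafilter ℕ) : Filter ℕ) ≤ atTop := Ultrafilter.of_le _
  have hex : ∀ a, ∃ x, Tendsto (fun k => W k a) (Ultrafilter.of atTop : Ultrafilter ℕ) (𝓝 x) :=
    fun a => by
      obtain ⟨M, hM⟩ := h.exists_bound_coord hX hY hε hτ hγ hrho a
      exact Ultrafilter.exists_tendsto_of_eventually_abs_le _ (hM.filter_mono hl)
  choose x hx using hex
  refine ⟨WithLp.toLp 2 x, mapClusterPt_iff_ultrafilter.2 ⟨_, hl, ?_⟩⟩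
  exact ((PiLp.continuous_toLp 2 _).tendsto x).comp (tendsto_pi_nhds.2 hx)

theorem inner_sum_gradH (Z₁ : Matrix (Fin n) (Fin r × Fin p) ℝ)
    (Z₂ : Matrix (Fin n) (Fin r × Fin q) ℝ) {x v : Var n p q r}
    (hv : v ∈ tangentSpaceAt (manifoldN r X Y) x) :
    ⟪(∑ i, ∑ j, Z₁ i j • gradH₁ X Y x (i, j)) + ∑ i, ∑ j, Z₂ i j • gradH₂ X Y x (i, j), v⟫ =
      frobInner Z₁ (h₁ X v) + frobInner Z₂ (h₂ Y v) := by
  simp only [inner_add_left, sum_inner, real_inner_smul_left, inner_gradH₁ hv, inner_gradH₂ hv]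
  rfl

/-- Limit points of the iterates are KKT points. -/
theorem IsGenerated.isKKT (h : IsGenerated X Y lu lv τ γ ε W L₁ L₂ rho)
    (hε : Tendsto ε atTop (𝓝 0)) (hτ : τ < 1) (hγ : 1 < γ) (hrho : 1 < rho 0)
    {x : Var n p q r} (hx : MapClusterPt x atTop W) : IsKKT X Y lu lv x := by
  obtain ⟨l, hl, hWl⟩ := mapClusterPt_iff_ultrafilter.1 hx
  obtain ⟨hr₁, hr₂⟩ := h.tendsto_residual hε hτ hγ hrho
  have hxN : x ∈ manifoldN r X Y :=
    (isClosed_manifoldN X Y).mem_of_tendsto hWl (Eventually.of_forall h.mem)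
  have hex₁ : ∀ i j, ∃ z, Tendsto (fun k => L₁ k i j) l (𝓝 z) := fun i j => by
    obtain ⟨M, hM⟩ := h.exists_bound₁ hε i j
    exact l.exists_tendsto_of_eventually_abs_le (hM.filter_mono hl)
  have hex₂ : ∀ i j, ∃ z, Tendsto (fun k => L₂ k i j) l (𝓝 z) := fun i j => by
    obtain ⟨M, hM⟩ := h.exists_bound₂ hε i j
    exact l.exists_tendsto_of_eventually_abs_le (hM.filter_mono hl)
  choose Z₁ hZ₁ using hex₁
  choose Z₂ hZ₂ using hex₂
  have hc₁ : ∀ i j, Continuous fun W : Var n p q r => h₁ X W i j := fun i j =>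
    (contDiff_h₁ X i j).continuous
  have hc₂ : ∀ i j, Continuous fun W : Var n p q r => h₂ Y W i j := fun i j =>
    (contDiff_h₂ Y i j).continuous
  have hc := continuous_nuclearPart (n := n) (p := p) (q := q) (r := r) lu lv
  obtain ⟨d, V, ψ, u₀, hψ, hu₀, hψx⟩ := exists_isInverseChart_manifoldN hxN
  have hlag : ∀ v ∈ tangentSpaceAt (manifoldN r X Y) x,
      0 ≤ fderiv ℝ (smoothPart X Y) x v - frobInner (Matrix.of Z₁) (h₁ X v)
        - frobInner (Matrix.of Z₂) (h₂ Y v)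
        + (nuclearPart n p q r lu lv (x + v) - nuclearPart n p q r lu lv x) := by
    intro v hv
    rw [← hψx] at hv
    obtain ⟨v', hv', hv'T⟩ := hψ.exists_tendsto_tangent hu₀ (hψx.symm ▸ hWl)
      (Eventually.of_forall h.mem) hv
    -- The tolerance for the iterate `W k` is `ε (k - 1)`; the truncated value at `k = 0` is
    -- discarded by `eventually_ge_atTop 1`.
    have hε' : Tendsto (fun k => ε (k - 1)) l (𝓝 0) :=
      (hε.comp (tendsto_sub_atTop_nat 1)).mono_left hl
    have hD : Tendsto (fun k => fderiv ℝ (smoothPart X Y) (W k) (v' k)) l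
        (𝓝 (fderiv ℝ (smoothPart X Y) x v)) :=
      (isBoundedBilinearMap_apply.continuous.tendsto _).comp
        (((((contDiff_smoothPart X Y).continuous_fderiv (by simp)).tendsto x).comp hWl).prodMk_nhds
          hv')
    have hlim := ((hD.sub (tendsto_frobInner (A₀ := Matrix.of Z₁) hZ₁
      (fun i j => ((hc₁ i j).tendsto v).comp hv'))).sub (tendsto_frobInner (A₀ := Matrix.of Z₂) hZ₂
      (fun i j => ((hc₂ i j).tendsto v).comp hv'))).add
      (((hc.tendsto _).comp (hWl.add hv')).sub ((hc.tendsto _).comp hWl))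
    have hlow : Tendsto (fun k => -(ε (k - 1) * ‖v' k‖)) l (𝓝 0) := by
      simpa using (hε'.mul hv'.norm).neg
    refine le_of_tendsto_of_tendsto hlow hlim ?_
    filter_upwards [hv'T, hl (eventually_ge_atTop 1)] with k hk hk1
    obtain ⟨k, rfl⟩ := Nat.exists_eq_add_of_le' hk1
    exact h.le_lagrangian k hk
  -- The Lagrangian subtracts the multiplier terms while the KKT condition adds them, hence the
  -- minus signs. The subgradient is the combination of constraint gradients with the limit
  -- multipliers.
  refine ⟨hxN, ?_, ?_, -Matrix.of Z₁, -Matrix.of Z₂,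
    (∑ i, ∑ j, Matrix.of Z₁ i j • gradH₁ X Y x (i, j)) +
      ∑ i, ∑ j, Matrix.of Z₂ i j • gradH₂ X Y x (i, j), ?_, ?_⟩
  · ext i j
    exact tendsto_nhds_unique (((hc₁ i j).tendsto x).comp hWl) ((hr₁ i j).mono_left hl)
  · ext i j
    exact tendsto_nhds_unique (((hc₂ i j).tendsto x).comp hWl) ((hr₂ i j).mono_left hl)
  · rw [objF_eq]
    refine mem_riemSubdiff_of_inner_le hψ hu₀ hψx
      ((contDiff_smoothPart X Y).contDiffAt.hasStrictFDerivAt (by simp)) hc ?_ fun v hv => ?_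
    · exact add_mem
        (sum_mem fun i _ => sum_mem fun j _ => Submodule.smul_mem _ _ (riemGrad_mem _ _ _))
        (sum_mem fun i _ => sum_mem fun j _ => Submodule.smul_mem _ _ (riemGrad_mem _ _ _))
    · rw [inner_sum_gradH _ _ hv]
      linarith [hlag v hv]
  · simp only [Matrix.neg_apply, neg_smul, Finset.sum_neg_distrib]
    abel

end SCCA

end

theorem mainTheorem2 {n p q r : ℕ}
    (X : Matrix (Fin n) (Fin p) ℝ) (Y : Matrix (Fin n) (Fin q) ℝ)
    (hX : (X.transpose * X).PosDef) (hY : (Y.transpose * Y).PosDef)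
    (lu lv τ γ : ℝ) (hlu : 0 ≤ lu) (hlv : 0 ≤ lv)
    (hτ : 0 < τ) (hτ1 : τ < 1) (hγ : 1 < γ)
    (ε : ℕ → ℝ) (hε : Filter.Tendsto ε Filter.atTop (nhds 0))
    (W : ℕ → SCCA.Var n p q r)
    (L₁ : ℕ → Matrix (Fin n) (Fin r × Fin p) ℝ) (L₂ : ℕ → Matrix (Fin n) (Fin r × Fin q) ℝ)
    (rho : ℕ → ℝ) (hrho : 1 < rho 0)
    (hgen : SCCA.IsGenerated X Y lu lv τ γ ε W L₁ L₂ rho) :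
    (∃ Wstar : SCCA.Var n p q r, MapClusterPt Wstar Filter.atTop W) ∧
    ∀ Wstar : SCCA.Var n p q r, MapClusterPt Wstar Filter.atTop W →
      SCCA.LICQ X Y Wstar → SCCA.IsKKT X Y lu lv Wstar := by
  -- Nonnegative weights are what keeps `nuclearPart` a seminorm.
  lift lu to NNReal using hlu
  lift lv to NNReal using hlv
  exact ⟨hgen.exists_mapClusterPt hX hY hε hτ1 hγ hrho,
    fun _ hx _ => hgen.isKKT hε hτ1 hγ hrho hx⟩
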